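/- Let $\mathbb F$ be a field and let $n,k,\delta$ be integers with $0\le\delta<k<n$. A convolutional code of rate $k/n$ is a free $\mathbb F[z]$-submodule $\mathfrak C\subseteq\mathbb F[z]^n$ of rank $k$. It can be written as $\mathfrak C=\{G(z)m(z) : m(z)\in\mathbb F[z]^k\}$ with a generator matrix $G(z)\in\mathbb F[z]^{n\times k}$ of full column rank. The degree of $\mathfrak C$ is the maximal degree of the $k\times k$ minors of $G(z)$, and $\mathfrak C$ is called an $(n,k,\delta)$ convolutional code if this degree is $\delta$. The code is non-catastrophic if $G(z_0)$ has rank $k$ for every $z_0\in\overline{\mathbb F}$ (neither notion depends on the choice of $G$). For $j\ge 0$ the $j$-th column distance of $\mathfrak C$ is $$d_j^c(\mathfrak C)=\min\Big\{\sum_{t=0}^j \mathrm{wt}(v_t) \;:\; v(z)=\sum_t v_tz^t\in\mathfrak C,\ v_0\neq 0\Big\},$$ where $\mathrm{wt}$ is the Hamming weight on $\mathbb F^n$. Put $L=\lfloor\delta/k\rfloor+\lfloor\delta/(n-k)\rfloor$. An $(n,k,\delta)$ convolutional code $\mathfrak C$ is MDP (has maximum distance profile) if $d_j^c(\mathfrak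 C)=(n-k)(j+1)+1$ for $j=0,\dots,L$. Theorem. There exists a non-catastrophic $(n,k,\delta)$ MDP convolutional code over $\mathbb F$ if at least one of the following holds: 1. $|\mathbb F|>\binom{(L+1)n-1}{(L+1)(n-k)-1}$; 2. $L\ge 1$ and $|\mathbb F|>S(n,k,\delta)$, where, with $m_j=\lfloor j/(n-k)\rfloor$, $$S(n,k,\delta)=\sum_{j=n-k+1}^{(n-k)L-1}\binom{n-1}{j-1}\binom{m_jn}{(m_j+1)(n-k)-j}\prod_{s=m_j+1}^{L}\binom{sn}{n-k} +\sum_{j=\max\{(n-k)L,\,n-k+1\}}^{(n-k)(L+1)-1}\binom{n-1}{j-1}\binom{Ln}{(L+1)(n-k)-j}+\binom{n-1}{(L+1)(n-k)-1}$$ (empty sums are $0$). -/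

import Mathlib

namespace ConvCode

variable {F : Type*} [Field F] {n : ℕ}

/-- `G ∈ F[z]^{n × k}` is a generator matrix of `C`: it has full column rank (its columns are
linearly independent over `F[z]`) and `C = {G(z) m(z) | m(z) ∈ F[z]^k}`. -/
def IsGeneratorMatrix {k : ℕ} (G : Matrix (Fin n) (Fin k) (Polynomial F))
    (C : Submodule (Polynomial F) (Fin n → Polynomial F)) : Prop :=
  LinearIndependent (Polynomial F) G.col ∧ C = LinearMap.range G.mulVecLin

/-- The maximal degree of the `k × k` minors of an `n × k` polynomial matrix. Vanishing minors
count as `0`, which does not matter for matrices of full column rank. -/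
noncomputable def maxMinorDegree {k : ℕ} (G : Matrix (Fin n) (Fin k) (Polynomial F)) : ℕ :=
  Finset.univ.sup fun e : Fin k ↪o Fin n => (G.submatrix e id).det.natDegree

/-- `C` is an `(n, k, δ)` convolutional code: a free `F[z]`-submodule of `F[z]^n` of rank `k`
and of degree `δ`. The degree is read off from any generator matrix: two of them differ by a
unimodular factor, which multiplies all `k × k` minors by the same nonzero constant. -/
structure IsConvolutionalCode (C : Submodule (Polynomial F) (Fin n → Polynomial F))
    (k δ : ℕ) : Prop where
  free : Module.Free (Polynomial F) C
  rank_eq : Module.finrank (Polynomial F) C = k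
  degree_eq : ∃ G : Matrix (Fin n) (Fin k) (Polynomial F),
    IsGeneratorMatrix G C ∧ maxMinorDegree G = δ

/-- `G(z)` is right prime: `G(z₀)` has full column rank for every `z₀` in the algebraic
closure of `F`. -/
def IsRightPrime {k : ℕ} (G : Matrix (Fin n) (Fin k) (Polynomial F)) : Prop :=
  ∀ z₀ : AlgebraicClosure F, (G.map fun p => Polynomial.aeval z₀ p).rank = k

/-- A code of rank `k` is non-catastrophic if one (equivalently, each) of its generator matrices
is right prime. -/
def IsNonCatastrophic (C : Submodule (Polynomial F) (Fin n → Polynomial F)) (k : ℕ) : Prop :=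
  ∃ G : Matrix (Fin n) (Fin k) (Polynomial F), IsGeneratorMatrix G C ∧ IsRightPrime G

/-- The coefficient vector `v_t ∈ F^n` of `v(z) = ∑ v_t z^t`. -/
def coeffVec (v : Fin n → Polynomial F) (t : ℕ) : Fin n → F := fun i => (v i).coeff t

open Classical in
/-- `wt(v_0) + ⋯ + wt(v_j)`, where `wt` is the Hamming weight. -/
noncomputable def truncatedWeight (v : Fin n → Polynomial F) (j : ℕ) : ℕ :=
  ∑ t ∈ Finset.range (j + 1), hammingNorm (coeffVec v t)

/-- The `j`-th column distance: the minimum of `wt(v_0) + ⋯ + wt(v_j)` over the codewords with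
`v_0 ≠ 0` (by convention `0` if there is no such codeword). -/
noncomputable def columnDistance (C : Submodule (Polynomial F) (Fin n → Polynomial F))
    (j : ℕ) : ℕ :=
  sInf {w | ∃ v ∈ C, coeffVec v 0 ≠ 0 ∧ truncatedWeight v j = w}

/-- `L = ⌊δ / k⌋ + ⌊δ / (n - k)⌋`. -/
def L (n k δ : ℕ) : ℕ := δ / k + δ / (n - k)

/-- A code of length `n`, rank `k` and degree `δ` has maximum distance profile. -/
def IsMDP (C : Submodule (Polynomial F) (Fin n → Polynomial F)) (k δ : ℕ) : Prop :=
  ∀ j ≤ L n k δ, columnDistance C j = (n - k) * (j + 1) + 1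

/-- The bound `S(n, k, δ)`. For `k < n` no subtraction below truncates. -/
def S (n k δ : ℕ) : ℕ :=
  (∑ j ∈ Finset.Ico (n - k + 1) ((n - k) * L n k δ),
      (n - 1).choose (j - 1)
        * ((j / (n - k)) * n).choose ((j / (n - k) + 1) * (n - k) - j)
        * ∏ s ∈ Finset.Icc (j / (n - k) + 1) (L n k δ), (s * n).choose (n - k))
  + (∑ j ∈ Finset.Ico (max ((n - k) * L n k δ) (n - k + 1)) ((n - k) * (L n k δ + 1)),
      (n - 1).choose (j - 1) * (L n k δ * n).choose ((L n k δ + 1) * (n - k) - j))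
  + (n - 1).choose ((L n k δ + 1) * (n - k) - 1)

end ConvCode

/-! Put r = n - k; since δ < k, L = ⌊δ/r⌋. Suppose H_0, …, H_L are r × n matrices such that every
column set of their sliding matrix which is not dependent for dimension reasons is independent
(`Superregular`). A codeword with v_0 ≠ 0 satisfying ∑ H_t v_{τ-t} = 0 for τ ≤ L must then have more
than r(j+1) nonzero entries up to time j: the support of a first counterexample is an admissible
column set, yet the entries give a dependency (`Superregular.lt_truncatedWeight`). The matching
upper bound is of Singleton type and only needs G(0) to have full rank
(`exists_truncatedWeight_le`).

No polynomial parity-check matrix is needed to pass from H to a code. As (L+1)r ≤ n, the rows of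
H_0, …, H_L are independent and extend to a basis b of F^n with dual basis a. The columns z a_c -
a_{c+r} (c < δ) and -a_{c+r} (c ≥ δ) generate a code on which the parity sums telescope; its degree
and its left inverse can be read off from duality.

The matrices H_t are found one column at a time. A new column must avoid one affine condition per
critical minor, so a field with more elements than critical minors suffices (`exists_add_notMem`,
`SuperregularOn.exists_setColumn`). Minors that split into triangular blocks cost nothing, and
smaller column sets extend to full ones. Both field bounds are estimates of the number of critical
sets: drop the distinguished column for the first, sort by the number j of columns in the leftmost
block for the second. -/

namespace ConvCode

/-! ### Sliding parity-check matrices and admissible column sets -/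

section Sliding

variable {F : Type*} [Field F] {n r : ℕ}

/-- The column of the truncated sliding parity-check matrix of `∑ H t z ^ t` that belongs to the
`x.2`-th coordinate when `x.1` further block rows follow; block rows are numbered from the
bottom. -/
def slidingColumn (H : ℕ → Fin r → Fin n → F) (x : ℕ × Fin n) : ℕ → Fin r → F :=
  fun p ρ => if p ≤ x.1 then H (x.1 - p) ρ x.2 else 0

/-- Column sets whose minors do not vanish for trivial reasons. -/
def Admissible (r : ℕ) (K : Finset (ℕ × Fin n)) : Prop :=
  ∀ u, (K.filter fun x => x.1 ≤ u).card ≤ (u + 1) * r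

/-- All the minors of the first `s + 1` block rows that are not trivially zero are nonzero. -/
def Superregular (H : ℕ → Fin r → Fin n → F) (s : ℕ) : Prop :=
  ∀ K : Finset (ℕ × Fin n), (∀ x ∈ K, x.1 ≤ s) → Admissible r K →
    LinearIndepOn F (slidingColumn H) (K : Set (ℕ × Fin n))

/-- Drop the first `u` terms of a sequence. -/
def dropTerms (F : Type*) [Field F] (r u : ℕ) : (ℕ → Fin r → F) →ₗ[F] (ℕ → Fin r → F) where
  toFun f := fun p => f (p + u)
  map_add' _ _ := rfl
  map_smul' _ _ := rfl

theorem dropTerms_slidingColumn_of_lt (H : ℕ → Fin r → Fin n → F) {x : ℕ × Fin n} {u : ℕ}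
    (h : x.1 < u) : dropTerms F r u (slidingColumn H x) = 0 := by
  funext p ρ
  have : ¬ p + u ≤ x.1 := by omega
  simp [dropTerms, slidingColumn, this]

theorem dropTerms_slidingColumn (H : ℕ → Fin r → Fin n → F) {x : ℕ × Fin n} {u : ℕ}
    (h : u ≤ x.1) : dropTerms F r u (slidingColumn H x) = slidingColumn H (x.1 - u, x.2) := by
  funext p ρ
  have h1 : p + u ≤ x.1 ↔ p ≤ x.1 - u := by omega
  have h2 : x.1 - (p + u) = x.1 - u - p := by omega
  simp only [dropTerms, slidingColumn, LinearMap.coe_mk, AddHom.coe_mk, h1, h2]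

theorem LinearIndepOn.union_of_map {ι V V' : Type*} [AddCommGroup V] [Module F V]
    [AddCommGroup V'] [Module F V'] (g : V →ₗ[F] V') {w : ι → V} {s t : Set ι}
    (hs : LinearIndepOn F w s) (hz : ∀ x ∈ s, g (w x) = 0) (ht : LinearIndepOn F (g ∘ w) t) :
    LinearIndepOn F w (s ∪ t) := by
  refine hs.union_of_quotient ?_
  have hle : Submodule.span F (w '' s) ≤ LinearMap.ker g := by
    rw [Submodule.span_le]
    rintro _ ⟨x, hx, rfl⟩
    exact hz x hx
  exact LinearIndependent.of_comp ((Submodule.span F (w '' s)).liftQ g hle) ht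

theorem Admissible.mono {K K' : Finset (ℕ × Fin n)} (h : Admissible r K') (hK : K ⊆ K') :
    Admissible r K := fun u =>
  (Finset.card_le_card (Finset.filter_subset_filter _ hK)).trans (h u)

theorem Admissible.card_le {K : Finset (ℕ × Fin n)} {s : ℕ} (h : Admissible r K)
    (hs : ∀ x ∈ K, x.1 ≤ s) : K.card ≤ (s + 1) * r := by
  have := h s
  rwa [Finset.filter_true_of_mem hs] at this

theorem linearIndepOn_dropTerms_comp {H : ℕ → Fin r → Fin n → F} {s u : ℕ}
    (hH : Superregular H s) {K : Finset (ℕ × Fin n)} (hu : ∀ x ∈ K, u ≤ x.1)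
    (hs : ∀ x ∈ K, x.1 ≤ s + u)
    (hK : ∀ v, (K.filter fun x => x.1 ≤ v + u).card ≤ (v + 1) * r) :
    LinearIndepOn F (dropTerms F r u ∘ slidingColumn H) (K : Set (ℕ × Fin n)) := by
  classical
  let φ : ℕ × Fin n → ℕ × Fin n := fun x => (x.1 - u, x.2)
  have hinj : Set.InjOn φ (K : Set (ℕ × Fin n)) := by
    intro x hx y hy hxy
    have h1 := hu x hx
    have h2 := hu y hy
    simp only [φ, Prod.mk.injEq] at hxy
    exact Prod.ext (by omega) hxy.2
  have key : LinearIndepOn F (slidingColumn H) ((K.image φ : Finset _) : Set (ℕ × Fin n)) := by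
    apply hH
    · intro y hy
      obtain ⟨x, hx, rfl⟩ := Finset.mem_image.1 hy
      have := hs x hx
      simp only [φ]
      omega
    · intro v
      rw [Finset.filter_image]
      refine Finset.card_image_le.trans ((Finset.card_le_card ?_).trans (hK v))
      intro x hx
      simp only [φ, Finset.mem_filter] at hx ⊢
      exact ⟨hx.1, by omega⟩
  rw [Finset.coe_image] at key
  exact (key.comp_of_image hinj).congr fun x hx => (dropTerms_slidingColumn H (hu x hx)).symm

/-- Tightness at u makes the matrix block triangular: the columns of level ≤ u fill the bottom u + 1
block rows and vanish above. Dropping these rows turns the remaining columns into an admissible set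
of lower level, so both diagonal blocks are covered by `Superregular H s`. -/
theorem Superregular.linearIndepOn_of_tight {H : ℕ → Fin r → Fin n → F} {s : ℕ}
    (hH : Superregular H s) {K : Finset (ℕ × Fin n)} (hs : ∀ x ∈ K, x.1 ≤ s + 1)
    (hK : Admissible r K) {u : ℕ} (hu : u ≤ s)
    (ht : (K.filter fun x => x.1 ≤ u).card = (u + 1) * r) :
    LinearIndepOn F (slidingColumn H) (K : Set (ℕ × Fin n)) := by
  classical
  have hlo : LinearIndepOn F (slidingColumn H)
      ((K.filter fun x => x.1 ≤ u : Finset _) : Set (ℕ × Fin n)) :=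
    hH _ (fun x hx => ((Finset.mem_filter.1 hx).2).trans hu)
      (hK.mono (Finset.filter_subset _ _))
  have hhi : LinearIndepOn F (dropTerms F r (u + 1) ∘ slidingColumn H)
      ((K.filter fun x => ¬ x.1 ≤ u : Finset _) : Set (ℕ × Fin n)) := by
    refine linearIndepOn_dropTerms_comp hH ?_ ?_ ?_
    · intro x hx
      have := (Finset.mem_filter.1 hx).2
      omega
    · intro x hx
      have := hs x (Finset.mem_filter.1 hx).1
      omega
    · intro v
      have h1 := hK (v + (u + 1))
      rw [← Finset.card_filter_add_card_filter_not (fun x : ℕ × Fin n => x.1 ≤ u),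
        Finset.filter_filter, Finset.filter_filter] at h1
      have h2 : (K.filter fun x => x.1 ≤ v + (u + 1) ∧ x.1 ≤ u) = K.filter fun x => x.1 ≤ u :=
        Finset.filter_congr fun x _ => by omega
      rw [h2, ht] at h1
      rw [Finset.filter_filter]
      have h3 : (K.filter fun x => ¬ x.1 ≤ u ∧ x.1 ≤ v + (u + 1)) =
          K.filter fun x => x.1 ≤ v + (u + 1) ∧ ¬ x.1 ≤ u :=
        Finset.filter_congr fun x _ => and_comm
      rw [h3]
      nlinarith
  have := LinearIndepOn.union_of_map _ hlo
    (fun x hx => dropTerms_slidingColumn_of_lt H (Nat.lt_succ_of_le (Finset.mem_filter.1 hx).2)) hhi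
  rwa [← Finset.coe_union, Finset.filter_union_filter_not_eq] at this

/-- Greedy choice from the highest level downwards: at stage j the set is enlarged to j * r columns
of level above s + 1 - j. The final lower bounds, together with the exact cardinality, say that `Q`
is admissible once the bottom block row is dropped. -/
theorem exists_subset_admissible_shift {K : Finset (ℕ × Fin n)} {s : ℕ}
    (hK : ∀ v ≤ s, (s + 1 - v) * r ≤ (K.filter fun x => v < x.1).card) :
    ∃ Q ⊆ K, (∀ x ∈ Q, 1 ≤ x.1) ∧ Q.card = (s + 1) * r ∧
      ∀ v ≤ s, (s + 1 - v) * r ≤ (Q.filter fun x => v < x.1).card := by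
  have key : ∀ j ≤ s + 1, ∃ Q ⊆ K.filter (fun x => s + 1 - j < x.1), Q.card = j * r ∧
      ∀ v ≤ s, s + 1 - j ≤ v → (s + 1 - v) * r ≤ (Q.filter fun x => v < x.1).card := by
    intro j
    induction j with
    | zero =>
      refine fun _ => ⟨∅, by simp, by simp, fun v hv hv' => ?_⟩
      omega
    | succ j ih =>
      intro hj
      obtain ⟨Q, hQ, hQc, hQv⟩ := ih (by omega)
      have hsub : K.filter (fun x => s + 1 - j < x.1) ⊆ K.filter (fun x => s + 1 - (j + 1) < x.1) :=
        Finset.monotone_filter_right _ fun x _ hx => by omega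
      have hcard := hK (s + 1 - (j + 1)) (by omega)
      have he : s + 1 - (s + 1 - (j + 1)) = j + 1 := by omega
      rw [he] at hcard
      obtain ⟨Q', hQQ', hQ', hc⟩ := Finset.exists_subsuperset_card_eq (hQ.trans hsub)
        (n := (j + 1) * r) (by rw [hQc]; nlinarith) hcard
      refine ⟨Q', hQ', hc, fun v hv hv' => ?_⟩
      rcases Nat.eq_or_lt_of_le hv' with h | h
      · rw [← h, he, ← hc, Finset.filter_true_of_mem]
        exact fun x hx => (Finset.mem_filter.1 (hQ' hx)).2
      · exact (hQv v hv (by omega)).trans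
          (Finset.card_le_card (Finset.filter_subset_filter _ hQQ'))
  obtain ⟨Q, hQ, hc, hv⟩ := key (s + 1) le_rfl
  refine ⟨Q, hQ.trans (Finset.filter_subset _ _), fun x hx => ?_, hc,
    fun v hvs => hv v hvs (by omega)⟩
  have := (Finset.mem_filter.1 (hQ hx)).2
  omega

/-- A dimension count. If the span contained the whole bottom block, it would have dimension at
least r plus the rank modulo that block. The latter is at least (s + 1) * r by the choice of `Q`,
and the total exceeds the number of columns by one. -/
theorem Superregular.exists_single_notMem_span {H : ℕ → Fin r → Fin n → F} {s : ℕ}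
    (hH : Superregular H s) {K : Finset (ℕ × Fin n)} (hs : ∀ x ∈ K, x.1 ≤ s + 1)
    (hc : K.card + 1 = (s + 2) * r)
    (hK : ∀ u ≤ s, (K.filter fun x => x.1 ≤ u).card < (u + 1) * r) :
    ∃ y : Fin r → F, (Pi.single 0 y : ℕ → Fin r → F) ∉
      Submodule.span F (slidingColumn H '' (K : Set (ℕ × Fin n))) := by
  classical
  by_contra! hcon
  have hsplit : ∀ (A : Finset (ℕ × Fin n)) (v : ℕ),
      (A.filter fun x => x.1 ≤ v).card + (A.filter fun x => v < x.1).card = A.card := by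
    intro A v
    rw [← Finset.card_filter_add_card_filter_not (s := A) (fun x => x.1 ≤ v)]
    simp only [not_le]
  obtain ⟨Q, hQK, hQ1, hQc, hQ⟩ := exists_subset_admissible_shift (r := r) (K := K) (s := s) (by
    -- The missing column in `hc` and the strict inequality in `hK` cancel, leaving exactly (s + 1 -
    -- v) * r.
    intro v hv
    have h1 := hsplit K v
    have h2 := hK v hv
    obtain ⟨d, rfl⟩ := Nat.exists_eq_add_of_le hv
    have h3 : v + d + 1 - v = d + 1 := by omega
    rw [h3]
    nlinarith)
  have hQi : LinearIndepOn F (dropTerms F r 1 ∘ slidingColumn H) (Q : Set (ℕ × Fin n)) := by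
    refine linearIndepOn_dropTerms_comp hH hQ1 (fun x hx => hs x (hQK hx)) fun v => ?_
    rcases Nat.lt_or_ge s (v + 1) with h | h
    · refine (Finset.card_filter_le _ _).trans ?_
      rw [hQc]
      gcongr
      omega
    · have h1 := hsplit Q (v + 1)
      have h2 := hQ (v + 1) h
      obtain ⟨d, rfl⟩ := Nat.exists_eq_add_of_le h
      have h3 : v + 1 + d + 1 - (v + 1) = d + 1 := by omega
      rw [h3] at h2
      nlinarith
  set W := Submodule.span F (slidingColumn H '' (K : Set (ℕ × Fin n))) with hW
  let e : Fin r → LinearMap.ker (dropTerms F r 1) := fun ρ =>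
    ⟨Pi.single 0 (Pi.single ρ 1), by
      rw [LinearMap.mem_ker]
      funext p
      simp [dropTerms]⟩
  have he : LinearIndependent F e := by
    rw [Fintype.linearIndependent_iff]
    intro g hg ρ
    have h1 := congrArg (fun f : LinearMap.ker (dropTerms F r 1) => (f : ℕ → Fin r → F) 0 ρ) hg
    simpa [e, Finset.sum_apply, Pi.single_apply] using h1
  have hmk : LinearIndependent F
      ((LinearMap.ker (dropTerms F r 1)).mkQ ∘ fun x : Q => slidingColumn H x) := by
    refine LinearIndependent.of_comp
      ((LinearMap.ker (dropTerms F r 1)).liftQ (dropTerms F r 1) le_rfl) ?_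
    exact hQi
  have hsum := LinearIndependent.sumElim_of_quotient he _ hmk
  have h1 := finrank_span_eq_card hsum
  have h2 : Submodule.span F (Set.range (Sum.elim (fun ρ => (e ρ : ℕ → Fin r → F))
      fun x : Q => slidingColumn H x)) ≤ W := by
    rw [Submodule.span_le]
    rintro _ ⟨ρ | x, rfl⟩
    · exact hcon _
    · exact Submodule.subset_span ⟨x, hQK x.2, rfl⟩
  have h3 : Module.finrank F W ≤ K.card := by
    have := finrank_span_finset_le_card (R := F) (K.image (slidingColumn H))
    rw [Finset.coe_image] at this
    exact this.trans Finset.card_image_le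
  have : FiniteDimensional F W :=
    FiniteDimensional.span_of_finite F ((K.finite_toSet).image _)
  have h4 := Submodule.finrank_mono h2
  rw [h1, Fintype.card_sum, Fintype.card_fin, Fintype.card_coe, hQc] at h4
  nlinarith

/-- A line joining a point good for `T` to a point good for `a` meets each bad set at most once,
since two bad points would put the whole line into the same `W k`. With fewer bad sets than scalars,
some point of the line is good for all. -/
theorem exists_add_notMem {κ V X : Type*} [AddCommGroup V] [Module F V] [AddCommGroup X]
    [Module F X] (T : Finset κ) (hT : (T.card : ℕ∞) < ENat.card F) (W : κ → Submodule F V)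
    (w : V) (f : X →ₗ[F] V) (h : ∀ k ∈ T, ∃ x, w + f x ∉ W k) :
    ∃ x, ∀ k ∈ T, w + f x ∉ W k := by
  classical
  induction T using Finset.induction_on with
  | empty => exact ⟨0, by simp⟩
  | insert a T ha ih =>
    obtain ⟨x, hx⟩ := ih (lt_of_le_of_lt (by gcongr; exact Finset.subset_insert a T) hT)
      fun k hk => h k (Finset.mem_insert_of_mem hk)
    obtain ⟨y, hy⟩ := h a (Finset.mem_insert_self a T)
    by_contra! hcon
    choose g hgT hg using fun c : F => hcon (x + c • (y - x))
    have hinj : Function.Injective fun c => (⟨g c, hgT c⟩ : (insert a T : Finset κ)) := by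
      intro c d hcd
      have hcd' : g c = g d := congrArg Subtype.val hcd
      by_contra hne
      have h1 := hg c
      have h2 := hg d
      rw [← hcd'] at h2
      have h3 : f (y - x) ∈ W (g c) := by
        have := (W (g c)).smul_mem (c - d)⁻¹ ((W (g c)).sub_mem h1 h2)
        have he : (c - d)⁻¹ • (w + f (x + c • (y - x)) - (w + f (x + d • (y - x)))) =
            f (y - x) := by
          rw [map_add, map_add, map_smul, map_smul, add_sub_add_left_eq_sub,
            add_sub_add_left_eq_sub, ← sub_smul, smul_smul,
            inv_mul_cancel₀ (sub_ne_zero.2 hne), one_smul]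
        rwa [he] at this
      have h4 : w + f x ∈ W (g c) := by
        have := (W (g c)).sub_mem h1 ((W (g c)).smul_mem c h3)
        rw [map_add, map_smul] at this
        convert this using 1
        abel
      have h5 : w + f y ∈ W (g c) := by
        have := (W (g c)).add_mem h4 h3
        rw [map_sub] at this
        convert this using 1
        abel
      rcases Finset.mem_insert.1 (hgT c) with h6 | h6
      · exact hy (h6 ▸ h5)
      · exact hx _ h6 h4
    have := ENat.card_le_card_of_injective hinj
    rw [ENat.card_eq_coe_fintype_card (α := (insert a T : Finset κ)), Fintype.card_coe] at this
    exact absurd hT (not_lt.2 this)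

end Sliding

/-! ### Choosing the coefficient matrices column by column -/

section Choosing

variable {F : Type*} [Field F] {n r : ℕ}

/-- The number of minors of the first `ℓ + 1` block rows that restrict the choice of column `i` of
the `ℓ`-th coefficient matrix is the size of this family. -/
noncomputable def criticalSets (r ℓ : ℕ) (i : Fin n) : Finset (Finset (ℕ × Fin n)) :=
  open Classical in
  ((Finset.range (ℓ + 1) ×ˢ Finset.univ).powersetCard ((ℓ + 1) * r)).filter fun K =>
    (ℓ, i) ∈ K ∧ Admissible r K ∧ (K.filter fun x => x.1 < ℓ).card < ℓ * r

/-- Replace column `i` of the `d`-th coefficient matrix by `y`. -/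
def setColumn (H : ℕ → Fin r → Fin n → F) (d : ℕ) (i : Fin n) (y : Fin r → F) :
    ℕ → Fin r → Fin n → F :=
  fun t ρ j => if t = d ∧ j = i then y ρ else H t ρ j

theorem slidingColumn_congr {H H' : ℕ → Fin r → Fin n → F} {x : ℕ × Fin n}
    (h : ∀ t ≤ x.1, ∀ ρ, H t ρ x.2 = H' t ρ x.2) : slidingColumn H x = slidingColumn H' x := by
  funext p ρ
  simp only [slidingColumn]
  split_ifs
  · exact h _ (Nat.sub_le _ _) _
  · rfl

theorem slidingColumn_setColumn_of_ne (H : ℕ → Fin r → Fin n → F) {d : ℕ} {i : Fin n}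
    (y : Fin r → F) {x : ℕ × Fin n} (hx : x.1 ≤ d) (hne : x ≠ (d, i)) :
    slidingColumn (setColumn H d i y) x = slidingColumn H x := by
  refine slidingColumn_congr fun t ht ρ => if_neg ?_
  rintro ⟨rfl, h⟩
  exact hne (Prod.ext (le_antisymm hx ht) h)

theorem slidingColumn_setColumn_self (H : ℕ → Fin r → Fin n → F) (d : ℕ) (i : Fin n)
    (y : Fin r → F) :
    slidingColumn (setColumn H d i y) (d, i) =
      slidingColumn (setColumn H d i 0) (d, i) +
        LinearMap.single F (fun _ : ℕ => Fin r → F) 0 y := by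
  funext p ρ
  rcases Nat.eq_zero_or_pos p with rfl | hp
  · simp [slidingColumn, setColumn]
  · by_cases hpd : p ≤ d
    · have : d - p ≠ d := by omega
      simp [slidingColumn, setColumn, this, Pi.single_eq_of_ne hp.ne']
    · simp [slidingColumn, hpd, Pi.single_eq_of_ne hp.ne']

theorem Superregular.congr {H H' : ℕ → Fin r → Fin n → F} {s : ℕ} (hH : Superregular H s)
    (h : ∀ t ≤ s, H t = H' t) : Superregular H' s := fun K hK hK' =>
  (hH K hK hK').congr fun x hx => slidingColumn_congr fun t ht ρ => by
    rw [h t (ht.trans (hK x hx))]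

/-- Like `Superregular H (s + 1)`, but of the leftmost block only the columns in `I` count. -/
def SuperregularOn (H : ℕ → Fin r → Fin n → F) (s : ℕ) (I : Finset (Fin n)) : Prop :=
  ∀ K : Finset (ℕ × Fin n), (∀ x ∈ K, x.1 ≤ s + 1) → (∀ x ∈ K, x.1 = s + 1 → x.2 ∈ I) →
    Admissible r K → LinearIndepOn F (slidingColumn H) (K : Set (ℕ × Fin n))

/-- Level s has n columns, more than `K` can contain. Adding one of them affects only the counts at
u ≥ s, and there is room at u = s by `ht` and beyond by `hc`. -/
theorem Admissible.exists_insert {K : Finset (ℕ × Fin n)} {s : ℕ} (hn : (s + 2) * r ≤ n)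
    (hK : Admissible r K) (hc : K.card < (s + 2) * r)
    (ht : (K.filter fun x => x.1 ≤ s).card < (s + 1) * r) :
    ∃ j : Fin n, (s, j) ∉ K ∧ Admissible r (insert (s, j) K) := by
  classical
  have hex : ∃ j : Fin n, (s, j) ∉ K := by
    by_contra! hcon
    have h1 : (Finset.univ : Finset (Fin n)).card ≤ K.card :=
      Finset.card_le_card_of_injOn (fun j => (s, j)) (fun j _ => hcon j)
        fun a _ b _ hab => (Prod.mk.inj hab).2
    rw [Finset.card_univ, Fintype.card_fin] at h1
    omega
  obtain ⟨j, hj⟩ := hex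
  refine ⟨j, hj, fun u => ?_⟩
  rw [Finset.filter_insert]
  split_ifs with h
  · refine (Finset.card_insert_le _ _).trans ?_
    change s ≤ u at h
    rcases Nat.eq_or_lt_of_le h with rfl | h'
    · exact ht
    · have h1 : (s + 2) * r ≤ (u + 1) * r := Nat.mul_le_mul_right r (by omega)
      have h2 := Finset.card_filter_le K fun x => x.1 ≤ u
      omega
  · exact hK u

/-- Changing `y` moves only the bottom block of the column (s + 1, i), so each full-size set
containing it demands that an affine family leave a fixed span. Tight sets are independent anyway,
and sets that are too small are enlarged at level s. -/
theorem SuperregularOn.exists_setColumn {H : ℕ → Fin r → Fin n → F} {s : ℕ} {I : Finset (Fin n)}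
    (hI : SuperregularOn H s I) (hH : Superregular H s) (hn : (s + 2) * r ≤ n) {i : Fin n}
    (hc : ((criticalSets r (s + 1) i).card : ℕ∞) < ENat.card F) :
    ∃ y, SuperregularOn (setColumn H (s + 1) i y) s (insert i I) := by
  classical
  -- `criticalSets` only excludes tightness at level s; the sets that are tight further down impose
  -- no condition either and are discarded here.
  let T := (criticalSets r (s + 1) i).filter fun K =>
    (∀ x ∈ K, x.1 = s + 1 → x.2 ∈ insert i I) ∧
      ∀ u ≤ s, (K.filter fun x => x.1 ≤ u).card < (u + 1) * r
  have hTc : (T.card : ℕ∞) < ENat.card F :=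
    lt_of_le_of_lt (by gcongr; exact Finset.filter_subset _ _) hc
  let W : Finset (ℕ × Fin n) → Submodule F (ℕ → Fin r → F) := fun K =>
    Submodule.span F (slidingColumn H '' ((K.erase (s + 1, i) : Finset _) : Set (ℕ × Fin n)))
  obtain ⟨y, hy⟩ := exists_add_notMem T hTc W (slidingColumn (setColumn H (s + 1) i 0) (s + 1, i))
    (LinearMap.single F (fun _ : ℕ => Fin r → F) 0) (by
      intro K hK
      simp only [T, criticalSets, Finset.mem_filter, Finset.mem_powersetCard] at hK
      obtain ⟨⟨⟨hKs, hKc⟩, hiK, hadm, -⟩, -, hnt⟩ := hK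
      have hs : ∀ x ∈ K.erase (s + 1, i), x.1 ≤ s + 1 := by
        intro x hx
        have := hKs (Finset.mem_of_mem_erase hx)
        simp only [Finset.mem_product, Finset.mem_range] at this
        omega
      obtain ⟨y, hy⟩ := hH.exists_single_notMem_span hs
        (by rw [Finset.card_erase_add_one hiK, hKc])
        (fun u hu => lt_of_le_of_lt (Finset.card_le_card
          (Finset.filter_subset_filter _ (Finset.erase_subset _ _))) (hnt u hu))
      -- If all choices of `y` failed, subtracting the choice 0 would put the whole bottom block
      -- into the span.
      by_contra! hcon
      refine hy ?_
      have := (W K).sub_mem (hcon y) (hcon 0)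
      rwa [map_zero, add_zero, add_sub_cancel_left] at this)
  refine ⟨y, ?_⟩
  have hH' : Superregular (setColumn H (s + 1) i y) s := hH.congr fun t ht => by
    funext ρ j
    have : t ≠ s + 1 := by omega
    simp [setColumn, this]
  have hold : ∀ K : Finset (ℕ × Fin n), (∀ x ∈ K, x.1 ≤ s + 1) →
      (∀ x ∈ K, x.1 = s + 1 → x.2 ∈ insert i I) → Admissible r K →
      LinearIndepOn F (slidingColumn (setColumn H (s + 1) i y))
        ((K.erase (s + 1, i) : Finset _) : Set (ℕ × Fin n)) := by
    intro K hs hK hadm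
    refine (hI (K.erase (s + 1, i)) (fun x hx => hs x (Finset.mem_of_mem_erase hx)) ?_
      (hadm.mono (Finset.erase_subset _ _))).congr fun x hx => ?_
    · intro x hx hx1
      rcases Finset.mem_insert.1 (hK x (Finset.mem_of_mem_erase hx) hx1) with h | h
      · exact absurd (Prod.ext hx1 h) (Finset.ne_of_mem_erase hx)
      · exact h
    · exact (slidingColumn_setColumn_of_ne H y (hs x (Finset.mem_of_mem_erase hx))
        (Finset.ne_of_mem_erase hx)).symm
  have hnew : ∀ m : ℕ, ∀ K : Finset (ℕ × Fin n), (s + 2) * r = K.card + m →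
      (∀ x ∈ K, x.1 ≤ s + 1) → (∀ x ∈ K, x.1 = s + 1 → x.2 ∈ insert i I) → Admissible r K →
      (s + 1, i) ∈ K →
      LinearIndepOn F (slidingColumn (setColumn H (s + 1) i y)) (K : Set (ℕ × Fin n)) := by
    -- Induction on the number m of columns missing from the full size (s + 2) * r.
    intro m
    induction m with
    | zero =>
      intro K hm hs hK hadm hiK
      by_cases ht : ∃ u ≤ s, (K.filter fun x => x.1 ≤ u).card = (u + 1) * r
      · obtain ⟨u, hu, ht⟩ := ht
        exact hH'.linearIndepOn_of_tight hs hadm hu ht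
      push Not at ht
      have hnt : ∀ u ≤ s, (K.filter fun x => x.1 ≤ u).card < (u + 1) * r := fun u hu =>
        lt_of_le_of_ne (hadm u) (ht u hu)
      have hKT : K ∈ T := by
        simp only [T, criticalSets, Finset.mem_filter, Finset.mem_powersetCard]
        refine ⟨⟨⟨fun x hx => ?_, hm.symm⟩, hiK, hadm, ?_⟩, hK, hnt⟩
        · have := hs x hx
          simp only [Finset.mem_product, Finset.mem_range, Finset.mem_univ, and_true]
          omega
        · simpa only [Nat.lt_succ_iff] using hnt s le_rfl
      have h1 := hy K hKT
      rw [← slidingColumn_setColumn_self] at h1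
      rw [← Finset.insert_erase hiK, Finset.coe_insert]
      refine (hold K hs hK hadm).insert ?_
      convert h1 using 2
      refine congrArg _ (Set.image_congr fun x hx => ?_)
      exact slidingColumn_setColumn_of_ne H y (hs x (Finset.mem_of_mem_erase hx))
        (Finset.ne_of_mem_erase hx)
    | succ m ih =>
      intro K hm hs hK hadm hiK
      by_cases ht : (K.filter fun x => x.1 ≤ s).card = (s + 1) * r
      · exact hH'.linearIndepOn_of_tight hs hadm le_rfl ht
      obtain ⟨j, hj, hadm'⟩ := hadm.exists_insert hn (by omega) (lt_of_le_of_ne (hadm s) ht)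
      refine (ih (insert (s, j) K) ?_ ?_ ?_ hadm' (Finset.mem_insert_of_mem hiK)).mono
        (Finset.coe_subset.2 (Finset.subset_insert _ _))
      · rw [Finset.card_insert_of_notMem hj]
        omega
      · intro x hx
        rcases Finset.mem_insert.1 hx with rfl | hx
        · exact Nat.le_succ s
        · exact hs x hx
      · intro x hx hx1
        rcases Finset.mem_insert.1 hx with rfl | hx
        · simp at hx1
        · exact hK x hx hx1
  intro K hs hK hadm
  by_cases hiK : (s + 1, i) ∈ K
  · have hle : K.card ≤ (s + 2) * r := hadm.card_le hs
    exact hnew ((s + 2) * r - K.card) K (by omega) hs hK hadm hiK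
  · have := hold K hs hK hadm
    rwa [Finset.erase_eq_of_notMem hiK] at this

theorem Superregular.exists_succ {H : ℕ → Fin r → Fin n → F} {s : ℕ} (hH : Superregular H s)
    (hn : (s + 2) * r ≤ n)
    (hc : ∀ i : Fin n, ((criticalSets r (s + 1) i).card : ℕ∞) < ENat.card F) :
    ∃ H' : ℕ → Fin r → Fin n → F, Superregular H' (s + 1) := by
  classical
  have key : ∀ I : Finset (Fin n), ∃ H' : ℕ → Fin r → Fin n → F,
      Superregular H' s ∧ SuperregularOn H' s I := by
    intro I
    induction I using Finset.induction_on with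
    | empty =>
      refine ⟨H, hH, fun K hs hK hadm => hH K (fun x hx => ?_) hadm⟩
      have h1 := hs x hx
      have h2 := hK x hx
      simp only [Finset.notMem_empty, imp_false] at h2
      omega
    | insert i I _ ih =>
      obtain ⟨H', h1, h2⟩ := ih
      obtain ⟨y, hy⟩ := h2.exists_setColumn h1 hn (hc i)
      refine ⟨_, h1.congr fun t ht => ?_, hy⟩
      funext ρ j
      have : t ≠ s + 1 := by omega
      simp [setColumn, this]
  obtain ⟨H', -, h⟩ := key Finset.univ
  exact ⟨H', fun K hs hadm => h K hs (fun x _ _ => Finset.mem_univ x.2) hadm⟩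

/-- A Vandermonde matrix with distinct nodes works over a field with at least n elements. -/
theorem exists_superregular_zero (hF : (n : ℕ∞) ≤ ENat.card F ∨ r = 1) :
    ∃ H : ℕ → Fin r → Fin n → F, Superregular H 0 := by
  classical
  have hf : ∃ f : Fin n → F, r = 1 ∨ Function.Injective f := by
    rcases hF with h | h
    · rcases finite_or_infinite F with hfin | hinf
      · have : Fintype F := Fintype.ofFinite F
        rw [ENat.card_eq_coe_fintype_card, Nat.cast_le] at h
        obtain ⟨f⟩ := Function.Embedding.nonempty_of_card_le
          (α := Fin n) (β := F) (by rwa [Fintype.card_fin])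
        exact ⟨f, Or.inr f.injective⟩
      · exact ⟨fun i => Infinite.natEmbedding F i,
          Or.inr ((Infinite.natEmbedding F).injective.comp Fin.val_injective)⟩
    · exact ⟨0, Or.inl h⟩
  obtain ⟨f, hf⟩ := hf
  -- For r = 1 only the exponent 0 occurs, so this is the all-ones row whatever `f` is.
  refine ⟨fun _ ρ i => f i ^ (ρ : ℕ), fun K hs hadm => ?_⟩
  have hc : K.card ≤ r := by simpa using hadm.card_le hs
  rw [linearIndepOn_finset_iff]
  intro g hg
  let e := K.equivFin.symm
  have hsum : ∀ ρ : Fin r, ∑ j : Fin K.card, g (e j) * f (e j : ℕ × Fin n).2 ^ (ρ : ℕ) = 0 := by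
    intro ρ
    have h1 := congrFun (congrFun hg 0) ρ
    rw [← Finset.sum_coe_sort, ← e.sum_comp] at h1
    simpa [Finset.sum_apply, slidingColumn] using h1
  have hzero : (fun j => g (e j)) = 0 := by
    rcases hf with rfl | hf
    · funext j
      have hsub : ∀ j', j' = j := fun j' => Fin.ext (by omega)
      have h2 := hsum 0
      rw [Finset.sum_eq_single j (fun j' _ h => absurd (hsub j') h) (by simp)] at h2
      simpa using h2
    · refine Matrix.eq_zero_of_forall_pow_sum_mul_pow_eq_zero
        (f := fun j => f (e j : ℕ × Fin n).2) ?_ fun ρ => hsum ⟨ρ, lt_of_lt_of_le ρ.2 hc⟩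
      intro a b hab
      have h3 := hf hab
      have ha := hs _ (e a).2
      have hb := hs _ (e b).2
      exact e.injective (Subtype.ext (Prod.ext (by omega) h3))
  intro x hx
  have := congrFun hzero (e.symm ⟨x, hx⟩)
  simpa using this

theorem exists_superregular {ℓ : ℕ} (hF : (n : ℕ∞) ≤ ENat.card F ∨ r = 1)
    (hn : (ℓ + 1) * r ≤ n)
    (hc : ∀ s < ℓ, ∀ i : Fin n, ((criticalSets r (s + 1) i).card : ℕ∞) < ENat.card F) :
    ∃ H : ℕ → Fin r → Fin n → F, Superregular H ℓ := by
  induction ℓ with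
  | zero => exact exists_superregular_zero hF
  | succ ℓ ih =>
    obtain ⟨H, hH⟩ := ih (le_trans (by gcongr; omega) hn) fun s hs => hc s (by omega)
    exact hH.exists_succ hn (hc ℓ (Nat.lt_succ_self ℓ))

end Choosing

/-! ### Counting critical sets -/

section Counting

variable {n r : ℕ}

/-- Raise every column by one level and fill level 0 with r fixed columns. Hence only the bound for
the last coefficient matrix matters. -/
theorem card_criticalSets_le_succ (hr : r ≤ n) (ℓ : ℕ) (i : Fin n) :
    (criticalSets r ℓ i).card ≤ (criticalSets r (ℓ + 1) i).card := by
  classical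
  obtain ⟨R, -, hR⟩ := Finset.exists_subset_card_eq
    (show r ≤ (Finset.univ : Finset (Fin n)).card by rwa [Finset.card_univ, Fintype.card_fin])
  let up : (ℕ × Fin n) ↪ (ℕ × Fin n) :=
    ⟨fun x => (x.1 + 1, x.2), fun x y h => by
      simp only [Prod.mk.injEq, add_left_inj] at h
      exact Prod.ext h.1 h.2⟩
  let bot : Fin n ↪ (ℕ × Fin n) := ⟨fun j => (0, j), fun x y h => (Prod.mk.inj h).2⟩
  have hupv : ∀ x, up x = (x.1 + 1, x.2) := fun _ => rfl
  have hbotv : ∀ j, bot j = (0, j) := fun _ => rfl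
  have hup : ∀ (K : Finset (ℕ × Fin n)) (u : ℕ),
      ((K.map up).filter fun x => x.1 ≤ u + 1).card = (K.filter fun x => x.1 ≤ u).card := by
    intro K u
    rw [Finset.filter_map, Finset.card_map]
    congr 1
    refine Finset.filter_congr fun x _ => ?_
    simp [hupv]
  have hdisj : ∀ K : Finset (ℕ × Fin n), Disjoint (K.map up) (R.map bot) := by
    intro K
    rw [Finset.disjoint_left]
    intro x hx hx'
    obtain ⟨a, -, rfl⟩ := Finset.mem_map.1 hx
    obtain ⟨b, -, hb⟩ := Finset.mem_map.1 hx'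
    simp [hupv, hbotv] at hb
  refine Finset.card_le_card_of_injOn (fun K => K.map up ∪ R.map bot) ?_ ?_
  · intro K hK
    simp only [criticalSets, Finset.coe_filter, Set.mem_ofPred_eq, Finset.mem_powersetCard] at hK ⊢
    obtain ⟨⟨hKs, hKc⟩, hiK, hadm, hlt⟩ := hK
    refine ⟨⟨?_, ?_⟩, ?_, ?_, ?_⟩
    · refine Finset.union_subset ?_ ?_
      · intro x hx
        obtain ⟨a, ha, rfl⟩ := Finset.mem_map.1 hx
        have := hKs ha
        simp only [Finset.mem_product, Finset.mem_range, Finset.mem_univ, and_true] at this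
        simp only [hupv, Finset.mem_product, Finset.mem_range, Finset.mem_univ, and_true]
        omega
      · intro x hx
        obtain ⟨a, ha, rfl⟩ := Finset.mem_map.1 hx
        simp [hbotv]
    · rw [Finset.card_union_of_disjoint (hdisj K), Finset.card_map, Finset.card_map, hKc, hR]
      ring
    · exact Finset.mem_union_left _ (Finset.mem_map.2 ⟨_, hiK, rfl⟩)
    · intro u
      rw [Finset.filter_union]
      refine (Finset.card_union_le _ _).trans ?_
      have h1 : ((R.map bot).filter fun x => x.1 ≤ u).card ≤ r :=
        (Finset.card_filter_le _ _).trans (by rw [Finset.card_map, hR])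
      rcases u with _ | u
      · have h2 : ((K.map up).filter fun x => x.1 ≤ 0) = ∅ := by
          refine Finset.filter_eq_empty_iff.2 fun x hx => ?_
          obtain ⟨a, -, rfl⟩ := Finset.mem_map.1 hx
          simp [hupv]
        rw [h2, Finset.card_empty]
        omega
      · have h2 := hadm u
        rw [← hup] at h2
        nlinarith
    · rw [Finset.filter_union]
      refine lt_of_le_of_lt (Finset.card_union_le _ _) ?_
      have h1 : ((R.map bot).filter fun x => x.1 < ℓ + 1).card ≤ r :=
        (Finset.card_filter_le _ _).trans (by rw [Finset.card_map, hR])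
      have h2 : ((K.map up).filter fun x => x.1 < ℓ + 1).card =
          (K.filter fun x => x.1 < ℓ).card := by
        rw [Finset.filter_map, Finset.card_map]
        congr 1
        refine Finset.filter_congr fun x _ => ?_
        simp [hupv]
      rw [h2]
      nlinarith
  · intro K _ K' _ h
    have hrec : ∀ K : Finset (ℕ × Fin n),
        (K.map up ∪ R.map bot).filter (fun x => 1 ≤ x.1) = K.map up := by
      intro K
      rw [Finset.filter_union, Finset.filter_true_of_mem, Finset.filter_false_of_mem,
        Finset.union_empty]
      · intro x hx
        obtain ⟨a, -, rfl⟩ := Finset.mem_map.1 hx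
        simp [hbotv]
      · intro x hx
        obtain ⟨a, -, rfl⟩ := Finset.mem_map.1 hx
        simp [hupv]
    have h' := congrArg (Finset.filter fun x : ℕ × Fin n => 1 ≤ x.1) h
    simp only [hrec] at h'
    exact Finset.map_injective up h'

theorem card_criticalSets_mono (hr : r ≤ n) (i : Fin n) :
    Monotone fun ℓ => (criticalSets r ℓ i).card :=
  monotone_nat_of_le_succ fun ℓ => card_criticalSets_le_succ hr ℓ i

theorem card_criticalSets_le_choose (ℓ : ℕ) (i : Fin n) :
    (criticalSets r ℓ i).card ≤ ((ℓ + 1) * n - 1).choose ((ℓ + 1) * r - 1) := by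
  classical
  let U : Finset (ℕ × Fin n) := Finset.range (ℓ + 1) ×ˢ Finset.univ
  have hU : (ℓ, i) ∈ U := by simp [U]
  have hc : ((U.erase (ℓ, i)).powersetCard ((ℓ + 1) * r - 1)).card =
      ((ℓ + 1) * n - 1).choose ((ℓ + 1) * r - 1) := by
    rw [Finset.card_powersetCard, Finset.card_erase_of_mem hU]
    simp [U]
  rw [← hc]
  refine Finset.card_le_card_of_injOn (fun K => K.erase (ℓ, i)) ?_ ?_
  · intro K hK
    simp only [criticalSets, Finset.coe_filter, Set.mem_ofPred_eq, Finset.mem_powersetCard] at hK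
    rw [Finset.mem_coe, Finset.mem_powersetCard]
    exact ⟨Finset.erase_subset_erase _ hK.1.1,
      by rw [Finset.card_erase_of_mem hK.2.1, hK.1.2]⟩
  · intro K hK K' hK' h
    simp only [criticalSets, Finset.coe_filter, Set.mem_ofPred_eq] at hK hK'
    simp only at h
    rw [← Finset.insert_erase hK.2.1, h, Finset.insert_erase hK'.2.1]

/-- Pick c elements from the top q levels below L, then r further ones from the top q + 1 levels,
and so on. Each pick is possible inside `R` by the lower bounds; the same set may arise repeatedly,
so the product is only an upper bound. -/
theorem exists_chain_cover (L q c t : ℕ) (ht : q + t ≤ L) :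
    ∃ 𝓕 : Finset (Finset (ℕ × Fin n)),
      𝓕.card ≤ (q * n).choose c * ∏ s ∈ Finset.Ico (q + 1) (q + t + 1), (s * n).choose r ∧
      ∀ R : Finset (ℕ × Fin n), (∀ x ∈ R, x.1 < L) →
        (∀ d, q + d ≤ L → c + d * r ≤ (R.filter fun x => L - (q + d) ≤ x.1).card) →
        ∃ R' ∈ 𝓕, R' ⊆ R.filter (fun x => L - (q + t) ≤ x.1) ∧ R'.card = c + t * r := by
  classical
  let U : ℕ → Finset (ℕ × Fin n) := fun ℓ => Finset.Ico (L - ℓ) L ×ˢ Finset.univ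
  have hU : ∀ ℓ ≤ L, (U ℓ).card = ℓ * n := by
    intro ℓ hℓ
    have : L - (L - ℓ) = ℓ := by omega
    simp [U, this]
  have hmemU : ∀ {ℓ : ℕ} {R : Finset (ℕ × Fin n)}, (∀ x ∈ R, x.1 < L) →
      R.filter (fun x => L - ℓ ≤ x.1) ⊆ U ℓ := by
    intro ℓ R hR x hx
    rw [Finset.mem_filter] at hx
    simp only [U, Finset.mem_product, Finset.mem_Ico, Finset.mem_univ, and_true]
    exact ⟨hx.2, hR x hx.1⟩
  induction t with
  | zero =>
    refine ⟨(U q).powersetCard c, ?_, fun R hR hcard => ?_⟩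
    · rw [Finset.card_powersetCard, hU q (by omega)]
      simp
    · have h0 := hcard 0 ht
      rw [zero_mul, add_zero] at h0
      obtain ⟨R', hR', hc⟩ := Finset.exists_subset_card_eq h0
      exact ⟨R', Finset.mem_powersetCard.2 ⟨hR'.trans (hmemU hR), hc⟩, hR', by simpa using hc⟩
  | succ t ih =>
    obtain ⟨𝓕, h𝓕, hcov⟩ := ih (by omega)
    refine ⟨(𝓕 ×ˢ (U (q + t + 1)).powersetCard r).image fun p => p.1 ∪ p.2, ?_,
      fun R hR hcard => ?_⟩
    · refine Finset.card_image_le.trans ?_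
      rw [Finset.card_product, Finset.card_powersetCard, hU (q + t + 1) ht, ← add_assoc,
        Finset.prod_Ico_succ_top (by omega), ← mul_assoc]
      exact Nat.mul_le_mul_right _ h𝓕
    · obtain ⟨R₁, hR₁, hsub, hc⟩ := hcov R hR hcard
      have hsub' : R₁ ⊆ R.filter fun x => L - (q + (t + 1)) ≤ x.1 :=
        hsub.trans (Finset.monotone_filter_right _ fun x _ hx => by omega)
      obtain ⟨R', hR₁', hR', hc'⟩ := Finset.exists_subsuperset_card_eq hsub'
        (n := c + (t + 1) * r) (by rw [hc]; nlinarith) (hcard (t + 1) ht)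
      refine ⟨R', Finset.mem_image.2 ⟨(R₁, R' \ R₁), Finset.mem_product.2 ⟨hR₁,
        Finset.mem_powersetCard.2 ⟨Finset.sdiff_subset.trans (hR'.trans (hmemU hR)), ?_⟩⟩,
        Finset.union_sdiff_of_subset hR₁'⟩, hR', hc'⟩
      rw [Finset.card_sdiff_of_subset hR₁', hc', hc]
      ring_nf
      omega

/-- Bound for the number of ways to complete `j` columns of the leftmost block to a column set
whose minor is not trivially zero. -/
def completionBound (n r L j : ℕ) : ℕ :=
  if j < r * L then
    ((j / r) * n).choose ((j / r + 1) * r - j) *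
      ∏ s ∈ Finset.Icc (j / r + 1) L, (s * n).choose r
  else (L * n).choose ((L + 1) * r - j)

/-- Read from the top, admissibility of a full-size set says that the levels ≥ L - ℓ contain at
least (ℓ + 1) * r columns. The j columns of level L meet this demand as long as (ℓ + 1) * r ≤ j, so
a chain of forced choices starts at ℓ = j / r. For j ≥ r * L only the size of the rest is used. -/
theorem exists_completion_cover (hr : 0 < r) (L j : ℕ) :
    ∃ 𝓕 : Finset (Finset (ℕ × Fin n)), 𝓕.card ≤ completionBound n r L j ∧
      ∀ K : Finset (ℕ × Fin n), (∀ x ∈ K, x.1 ≤ L) → Admissible r K → K.card = (L + 1) * r →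
        (K.filter fun x => x.1 = L).card = j → (K.filter fun x => x.1 < L) ∈ 𝓕 := by
  classical
  have hsum : ∀ K : Finset (ℕ × Fin n), (∀ x ∈ K, x.1 ≤ L) → ∀ u ≤ L,
      (K.filter fun x => x.1 < u).card + (((K.filter fun x => x.1 < L).filter
        fun x => u ≤ x.1).card + (K.filter fun x => x.1 = L).card) = K.card := by
    intro K hK u hu
    rw [← Finset.card_filter_add_card_filter_not (s := K) fun x => x.1 < u]
    congr 1
    rw [← Finset.card_filter_add_card_filter_not (s := K.filter fun x => ¬ x.1 < u)
      fun x => x.1 < L, Finset.filter_filter, Finset.filter_filter, Finset.filter_filter]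
    congr 2
    · exact Finset.filter_congr fun x _ => by omega
    · exact Finset.filter_congr fun x hx => by have := hK x hx; omega
  by_cases hj : j < r * L
  · have hq : j / r < L := Nat.div_lt_of_lt_mul hj
    have hq' : j < (j / r + 1) * r := by
      rw [mul_comm]
      exact Nat.lt_mul_div_succ j hr
    obtain ⟨𝓕, h𝓕, hcov⟩ := exists_chain_cover (n := n) (r := r) L (j / r)
      ((j / r + 1) * r - j) (L - j / r) (by omega)
    refine ⟨𝓕, ?_, fun K hK hadm hKc hKj => ?_⟩
    · rw [completionBound, if_pos hj]
      convert h𝓕 using 3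
      ext s
      simp only [Finset.mem_Icc, Finset.mem_Ico]
      omega
    · obtain ⟨R', hR', hsub, hc⟩ := hcov (K.filter fun x => x.1 < L)
        (fun x hx => (Finset.mem_filter.1 hx).2) (by
          intro d hd
          have h1 := hsum K hK (L - (j / r + d)) (Nat.sub_le _ _)
          rw [hKj, hKc] at h1
          have h2 : (K.filter fun x => x.1 < L - (j / r + d)).card ≤ (L - (j / r + d)) * r := by
            rcases Nat.eq_zero_or_pos (L - (j / r + d)) with h | h
            · simp [h]
            · obtain ⟨u, hu⟩ := Nat.exists_eq_succ_of_ne_zero h.ne'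
              rw [hu]
              simpa only [Nat.lt_succ_iff] using hadm u
          obtain ⟨e, he⟩ := Nat.exists_eq_add_of_le hd
          have h3 : L - (j / r + d) = e := Nat.sub_eq_of_eq_add' he
          have h4 : (L + 1) * r = (j / r + 1) * r + d * r + e * r := by
            rw [he]
            ring
          rw [h3] at h1 h2 ⊢
          omega)
      have h5 : R' = K.filter fun x => x.1 < L := by
        refine Finset.eq_of_subset_of_card_le (hsub.trans (Finset.filter_subset _ _)) ?_
        have h1 := hsum K hK 0 (Nat.zero_le L)
        have h6 : ((K.filter fun x => x.1 < L).filter fun x => 0 ≤ x.1) =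
            K.filter fun x => x.1 < L := Finset.filter_true_of_mem fun x _ => Nat.zero_le _
        rw [h6, hKj, hKc] at h1
        obtain ⟨e, he⟩ := Nat.exists_eq_add_of_le hq.le
        have h7 : L - j / r = e := Nat.sub_eq_of_eq_add' he
        have h8 : (L + 1) * r = (j / r + 1) * r + e * r := by
          nth_rewrite 1 [he]
          ring
        rw [hc, h7]
        omega
      exact h5 ▸ hR'
  · refine ⟨(Finset.range L ×ˢ Finset.univ).powersetCard ((L + 1) * r - j), ?_,
      fun K hK _ hKc hKj => ?_⟩
    · rw [completionBound, if_neg hj, Finset.card_powersetCard]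
      simp
    · rw [Finset.mem_powersetCard]
      refine ⟨fun x hx => ?_, ?_⟩
      · simpa using (Finset.mem_filter.1 hx).2
      · have h1 := hsum K hK L le_rfl
        have h2 : ((K.filter fun x => x.1 < L).filter fun x => L ≤ x.1) = ∅ :=
          Finset.filter_eq_empty_iff.2 fun x hx => by
            have := (Finset.mem_filter.1 hx).2
            omega
        rw [h2, Finset.card_empty, hKj, hKc] at h1
        omega

theorem card_criticalSets_le_sum (hr : 0 < r) (L : ℕ) (i : Fin n) :
    (criticalSets r L i).card ≤
      ∑ j ∈ Finset.Ico (r + 1) ((L + 1) * r + 1),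
        (n - 1).choose (j - 1) * completionBound n r L j := by
  classical
  have hmaps : ∀ K ∈ criticalSets r L i,
      -- At least r + 1 columns have level L, because fewer than L * r lie below.
      (K.filter fun x => x.1 = L).card ∈ Finset.Ico (r + 1) ((L + 1) * r + 1) := by
    intro K hK
    simp only [criticalSets, Finset.mem_filter, Finset.mem_powersetCard] at hK
    obtain ⟨⟨hKs, hKc⟩, -, -, hlt⟩ := hK
    have h1 := Finset.card_filter_add_card_filter_not (s := K) fun x => x.1 < L
    have h2 : (K.filter fun x => ¬ x.1 < L) = K.filter fun x => x.1 = L :=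
      Finset.filter_congr fun x hx => by
        have := hKs hx
        simp only [Finset.mem_product, Finset.mem_range] at this
        omega
    rw [h2, hKc] at h1
    rw [Finset.mem_Ico]
    have : (L + 1) * r = L * r + r := by ring
    omega
  rw [Finset.card_eq_sum_card_fiberwise hmaps]
  refine Finset.sum_le_sum fun j _ => ?_
  obtain ⟨𝓕, h𝓕, hcov⟩ := exists_completion_cover (n := n) hr L j
  let V : Finset (ℕ × Fin n) := ({L} ×ˢ Finset.univ).erase (L, i)
  have hV : V.card = n - 1 := by
    rw [Finset.card_erase_of_mem (by simp)]
    simp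
  refine le_trans ?_ (Nat.mul_le_mul_left _ h𝓕)
  rw [← hV, ← Finset.card_powersetCard, ← Finset.card_product]
  have hmem : ∀ {K : Finset (ℕ × Fin n)}, (L, i) ∈ K → (L, i) ∈ K.filter fun x => x.1 = L :=
    fun h => Finset.mem_filter.2 ⟨h, rfl⟩
  have hsplit : ∀ K ∈ criticalSets r L i,
      K = insert (L, i) ((K.filter fun x => x.1 = L).erase (L, i)) ∪
        K.filter fun x => x.1 < L := by
    intro K hK
    simp only [criticalSets, Finset.mem_filter, Finset.mem_powersetCard] at hK
    rw [Finset.insert_erase (hmem hK.2.1), ← Finset.filter_or]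
    refine (Finset.filter_true_of_mem fun x hx => ?_).symm
    have := hK.1.1 hx
    simp only [Finset.mem_product, Finset.mem_range] at this
    omega
  refine Finset.card_le_card_of_injOn
    (fun K => ((K.filter fun x => x.1 = L).erase (L, i), K.filter fun x => x.1 < L)) ?_ ?_
  · intro K hK
    rw [Finset.mem_coe, Finset.mem_filter] at hK
    obtain ⟨hK, hKj⟩ := hK
    simp only [criticalSets, Finset.mem_filter, Finset.mem_powersetCard] at hK
    obtain ⟨⟨hKs, hKc⟩, hiK, hadm, -⟩ := hK
    rw [Finset.mem_coe, Finset.mem_product, Finset.mem_powersetCard]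
    refine ⟨⟨Finset.erase_subset_erase _ fun x hx => ?_, ?_⟩, hcov K (fun x hx => ?_) hadm hKc hKj⟩
    · rw [Finset.mem_product, Finset.mem_singleton]
      exact ⟨(Finset.mem_filter.1 hx).2, Finset.mem_univ _⟩
    · exact (Finset.card_erase_of_mem (hmem hiK)).trans (by rw [hKj])
    · have := hKs hx
      simp only [Finset.mem_product, Finset.mem_range] at this
      omega
  · intro K hK K' hK' h
    rw [Finset.mem_coe, Finset.mem_filter] at hK hK'
    simp only [Prod.mk.injEq] at h
    rw [hsplit K hK.1, hsplit K' hK'.1, h.1, h.2]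

theorem card_criticalSets_le_S {k δ : ℕ} (hkn : k < n) (hL : 1 ≤ L n k δ) (i : Fin n) :
    (criticalSets (n - k) (L n k δ) i).card ≤ S n k δ := by
  have hr : 0 < n - k := by omega
  refine (card_criticalSets_le_sum hr _ i).trans (le_of_eq ?_)
  rw [S]
  generalize L n k δ = ℓ at *
  generalize n - k = r at *
  have hle : r + 1 ≤ (ℓ + 1) * r := by nlinarith
  rw [Finset.sum_Ico_succ_top hle]
  have h1 : completionBound n r ℓ ((ℓ + 1) * r) = 1 := by
    rw [completionBound, if_neg (by nlinarith)]
    simp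
  rw [h1, mul_one]
  congr 1
  rw [mul_comm (ℓ + 1) r]
  have h2 : ∑ j ∈ Finset.Ico (r + 1) (r * (ℓ + 1)),
      (n - 1).choose (j - 1) * completionBound n r ℓ j =
      ∑ j ∈ Finset.Ico (r + 1) (r * ℓ), (n - 1).choose (j - 1) * completionBound n r ℓ j +
      ∑ j ∈ Finset.Ico (max (r * ℓ) (r + 1)) (r * (ℓ + 1)),
        (n - 1).choose (j - 1) * completionBound n r ℓ j := by
    -- The first sum is empty when r * ℓ ≤ r + 1; this is why the second starts at a maximum.
    rcases le_total (r * ℓ) (r + 1) with h | h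
    · rw [Finset.Ico_eq_empty_of_le h, max_eq_right h, Finset.sum_empty, zero_add]
    · rw [max_eq_left h, Finset.sum_Ico_consecutive _ h (by nlinarith)]
  rw [h2]
  congr 1
  · refine Finset.sum_congr rfl fun j hj => ?_
    rw [completionBound, if_pos (Finset.mem_Ico.1 hj).2, mul_assoc]
  · refine Finset.sum_congr rfl fun j hj => ?_
    have := (Finset.mem_Ico.1 hj).1
    rw [completionBound, if_neg (by omega), mul_comm r (ℓ + 1)]

end Counting

open Polynomial

/-! ### Maximal minors and column degrees -/

section Minors

variable {F : Type*} [Field F] {n k : ℕ}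

theorem exists_orderEmb_det_ne_zero (M : Matrix (Fin n) (Fin k) F)
    (hM : LinearIndependent F M.col) : ∃ e : Fin k ↪o Fin n, (M.submatrix e id).det ≠ 0 := by
  classical
  have hrank : Module.finrank F (Submodule.span F (Set.range M.row)) = k := by
    have h1 := LinearIndependent.rank_matrix (M := M.transpose) hM
    rw [← Matrix.rank_eq_finrank_span_row, ← Matrix.rank_transpose, h1, Fintype.card_fin]
  obtain ⟨κ, a, ha, hspan, hli⟩ := exists_linearIndependent' F M.row
  have : Finite κ := Finite.of_injective a ha
  have : Fintype κ := Fintype.ofFinite κ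
  have hc := finrank_span_eq_card hli
  rw [hspan, hrank] at hc
  have ht : (Finset.univ.image a).card = k := by
    rw [Finset.card_image_of_injective _ ha, Finset.card_univ, ← hc]
  let e := (Finset.univ.image a).orderEmbOfFin ht
  refine ⟨e, ?_⟩
  have hmem : ∀ c, ∃ x, a x = e c := fun c => by
    have := Finset.orderEmbOfFin_mem (Finset.univ.image a) ht c
    exact (Finset.mem_image.1 this).imp fun x hx => hx.2
  choose g hg using hmem
  have hginj : Function.Injective g := fun c d hcd => e.injective (by rw [← hg, ← hg, hcd])
  have hrow : LinearIndependent F (M.submatrix e id).row := by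
    have h2 : (M.submatrix e id).row = (M.row ∘ a) ∘ g := by
      funext c j
      change M (e c) j = M (a (g c)) j
      rw [hg]
    rw [h2]
    exact hli.comp g hginj
  exact ((Matrix.isUnit_iff_isUnit_det _).1 (Matrix.linearIndependent_rows_iff_isUnit.1 hrow)).ne_zero

theorem natDegree_prod_le_sum_and_coeff {ι : Type*} (s : Finset ι) (f : ι → F[X]) (d : ι → ℕ)
    (h : ∀ i ∈ s, (f i).natDegree ≤ d i) :
    (∏ i ∈ s, f i).natDegree ≤ ∑ i ∈ s, d i ∧
      (∏ i ∈ s, f i).coeff (∑ i ∈ s, d i) = ∏ i ∈ s, (f i).coeff (d i) := by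
  classical
  induction s using Finset.induction_on with
  | empty => simp
  | insert a s ha ih =>
    obtain ⟨h1, h2⟩ := ih fun i hi => h i (Finset.mem_insert_of_mem hi)
    have h3 := h a (Finset.mem_insert_self a s)
    rw [Finset.prod_insert ha, Finset.sum_insert ha, Finset.prod_insert ha]
    exact ⟨natDegree_mul_le_of_le h3 h1, by rw [coeff_mul_add_eq_of_natDegree_le h3 h1, h2]⟩

theorem natDegree_det_le_sum_and_coeff (P : Matrix (Fin k) (Fin k) F[X]) (d : Fin k → ℕ)
    (h : ∀ i c, (P i c).natDegree ≤ d c) :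
    P.det.natDegree ≤ ∑ c, d c ∧
      P.det.coeff (∑ c, d c) = (Matrix.of fun i c => (P i c).coeff (d c)).det := by
  have key := fun σ : Equiv.Perm (Fin k) =>
    natDegree_prod_le_sum_and_coeff Finset.univ (fun c => P (σ c) c) d fun c _ => h (σ c) c
  rw [Matrix.det_apply, Matrix.det_apply]
  constructor
  · refine natDegree_sum_le_of_forall_le _ _ fun σ _ => ?_
    exact (natDegree_smul_le _ _).trans (key σ).1
  · rw [finsetSum_coeff]
    refine Finset.sum_congr rfl fun σ _ => ?_
    rw [coeff_smul, (key σ).2]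
    rfl

/-- The coefficient of a minor in degree ∑ d c is the corresponding minor of the leading coefficient
matrix, and one of these is nonzero. -/
theorem maxMinorDegree_eq_sum (G : Matrix (Fin n) (Fin k) F[X]) (d : Fin k → ℕ)
    (h : ∀ i c, (G i c).natDegree ≤ d c)
    (hlead : LinearIndependent F (Matrix.of fun i c => (G i c).coeff (d c)).col) :
    maxMinorDegree G = ∑ c, d c := by
  have key := fun e : Fin k ↪o Fin n =>
    natDegree_det_le_sum_and_coeff (G.submatrix e id) d fun i c => h (e i) c
  refine le_antisymm (Finset.sup_le fun e _ => (key e).1) ?_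
  obtain ⟨e, he⟩ := exists_orderEmb_det_ne_zero _ hlead
  refine le_trans ?_ (Finset.le_sup (f := fun e : Fin k ↪o Fin n =>
    (G.submatrix e id).det.natDegree) (Finset.mem_univ e))
  refine le_natDegree_of_ne_zero ?_
  rw [(key e).2]
  exact he

end Minors

/-! ### Bounds for the column distances -/

section Distance

variable {F : Type*} [Field F] {n k r : ℕ}

/-- A k × k block `P` with P(0) invertible is invertible modulo z^(j+1). Some codeword is therefore
a unit vector on these k rows up to time j, and only the other n - k rows contribute further weight.
-/
theorem exists_truncatedWeight_le (hk : 0 < k) (G : Matrix (Fin n) (Fin k) F[X])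
    (hG : LinearIndependent F (Matrix.of fun i c => (G i c).coeff 0).col) (j : ℕ) :
    ∃ v ∈ LinearMap.range G.mulVecLin, coeffVec v 0 ≠ 0 ∧
      truncatedWeight v j ≤ (n - k) * (j + 1) + 1 := by
  classical
  obtain ⟨e, he⟩ := exists_orderEmb_det_ne_zero _ hG
  set P := G.submatrix e id
  have hdet : ¬ X ∣ P.det := by
    rw [X_dvd_iff]
    have : P.det.coeff 0 = (P.map constantCoeff).det := by
      rw [← constantCoeff_apply, RingHom.map_det]
      rfl
    rw [this]
    exact he
  have hco : IsCoprime (X ^ (j + 1)) P.det :=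
    ((irreducible_X.coprime_iff_not_dvd).2 hdet).pow_left
  obtain ⟨a, b, hab⟩ := hco
  let c₀ : Fin k := ⟨0, hk⟩
  -- `b` inverts det P modulo X ^ (j + 1), so b • adj(P) is an inverse of `P` to that precision.
  let m : Fin k → F[X] := b • (P.adjugate.mulVec (Pi.single c₀ 1))
  have hPm : ∀ c, (P.mulVec m) c = if c = c₀ then 1 - a * X ^ (j + 1) else 0 := by
    intro c
    simp only [m]
    rw [Matrix.mulVec_smul, Matrix.mulVec_mulVec, Matrix.mul_adjugate, Matrix.smul_mulVec,
      Matrix.one_mulVec]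
    simp only [Pi.smul_apply, Pi.single_apply, smul_eq_mul]
    split_ifs
    · linear_combination hab
    · simp
  have hv : ∀ c, (G.mulVec m) (e c) = if c = c₀ then 1 - a * X ^ (j + 1) else 0 := hPm
  have hcoeff : ∀ c, ∀ t ≤ j, coeffVec (G.mulVec m) t (e c) =
      if c = c₀ ∧ t = 0 then 1 else 0 := by
    intro c t ht
    rw [coeffVec, hv]
    by_cases hc : c = c₀
    · have : ¬ j + 1 ≤ t := by omega
      simp [hc, coeff_one, coeff_mul_X_pow', this]
    · simp [hc]
  have hnorm : ∀ (t : ℕ) (s : Finset (Fin k)),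
      (∀ c ∈ s, coeffVec (G.mulVec m) t (e c) = 0) →
      hammingNorm (coeffVec (G.mulVec m) t) ≤ n - s.card := by
    intro t s hs
    have h1 : (Finset.univ.filter fun i => coeffVec (G.mulVec m) t i ≠ 0) ⊆
        Finset.univ \ s.map e.toEmbedding := by
      intro i hi
      rw [Finset.mem_sdiff]
      refine ⟨Finset.mem_univ i, fun h => ?_⟩
      obtain ⟨c, hc, rfl⟩ := Finset.mem_map.1 h
      exact (Finset.mem_filter.1 hi).2 (hs c hc)
    refine (Finset.card_le_card h1).trans ?_
    rw [Finset.card_sdiff_of_subset (Finset.subset_univ _), Finset.card_map, Finset.card_univ,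
      Fintype.card_fin]
  refine ⟨G.mulVec m, ⟨m, rfl⟩, fun h => ?_, ?_⟩
  · have := hcoeff c₀ 0 (Nat.zero_le j)
    rw [h] at this
    simp at this
  · have hkn : k ≤ n := by simpa using Fintype.card_le_of_embedding e.toEmbedding
    rw [truncatedWeight, Finset.sum_range_succ']
    have h0 := hnorm 0 (Finset.univ.erase c₀) fun c hc => by
      rw [hcoeff c 0 (Nat.zero_le j), if_neg]
      exact fun h => Finset.ne_of_mem_erase hc h.1
    rw [Finset.card_erase_of_mem (Finset.mem_univ _), Finset.card_univ, Fintype.card_fin] at h0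
    have h1 : ∑ t ∈ Finset.range j, hammingNorm (coeffVec (G.mulVec m) (t + 1)) ≤
        ∑ _t ∈ Finset.range j, (n - k) := by
      refine Finset.sum_le_sum fun t ht => ?_
      have := hnorm (t + 1) Finset.univ fun c _ => by
        rw [hcoeff c (t + 1) (Finset.mem_range.1 ht), if_neg]
        simp
      simpa using this
    rw [Finset.sum_const, Finset.card_range, smul_eq_mul] at h1
    have h2 : (n - k) * (j + 1) = j * (n - k) + (n - k) := by ring
    omega

open Classical in
/-- The support of `v_0, …, v_j`, with time counted backwards from `j`. -/
noncomputable def truncatedSupport (v : Fin n → F[X]) (j : ℕ) : Finset (ℕ × Fin n) :=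
  (Finset.range (j + 1) ×ˢ Finset.univ).filter fun x => (v x.2).coeff (j - x.1) ≠ 0

theorem card_truncatedSupport_filter (v : Fin n → F[X]) {j u : ℕ} (hu : u ≤ j) :
    ((truncatedSupport v j).filter fun x => u ≤ x.1).card = truncatedWeight v (j - u) := by
  classical
  have h1 : ((truncatedSupport v j).filter fun x => u ≤ x.1) =
      (Finset.Ico u (j + 1) ×ˢ Finset.univ).filter fun x => (v x.2).coeff (j - x.1) ≠ 0 := by
    ext x
    simp only [truncatedSupport, Finset.mem_filter, Finset.mem_product, Finset.mem_range,
      Finset.mem_Ico, Finset.mem_univ, and_true]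
    tauto
  rw [h1, Finset.card_filter, Finset.sum_product]
  simp only [← Finset.card_filter]
  have h2 := Finset.sum_Ico_reflect (fun t => hammingNorm (coeffVec v t)) u (le_refl (j + 1))
  have h3 : j + 1 - u = j - u + 1 := by omega
  rw [h3, Nat.sub_self, ← Finset.range_eq_Ico] at h2
  rw [truncatedWeight, ← h2]
  rfl

/-- At the first j violating the bound, the earlier truncations are heavy, so few support columns
are left at low levels and the support is admissible. Its columns are then independent, while the
parity equations are a dependency with coefficient v_0 ≠ 0 at level j. -/
theorem Superregular.lt_truncatedWeight {H : ℕ → Fin r → Fin n → F} {s : ℕ}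
    (hH : Superregular H s) {v : Fin n → F[X]}
    (hpar : ∀ τ ≤ s, ∀ ρ, ∑ t ∈ Finset.range (τ + 1), ∑ i, H t ρ i * (v i).coeff (τ - t) = 0)
    (hv : coeffVec v 0 ≠ 0) : ∀ j ≤ s, (j + 1) * r < truncatedWeight v j := by
  classical
  intro j
  induction j using Nat.strong_induction_on with
  | _ j ih =>
    intro hj
    by_contra! hcon
    have hcard : (truncatedSupport v j).card ≤ (j + 1) * r := by
      have := card_truncatedSupport_filter v (Nat.zero_le j)
      rw [Finset.filter_true_of_mem fun x _ => Nat.zero_le _, Nat.sub_zero] at this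
      rwa [this]
    have hle : ∀ x ∈ truncatedSupport v j, x.1 ≤ j := by
      intro x hx
      simp only [truncatedSupport, Finset.mem_filter, Finset.mem_product, Finset.mem_range] at hx
      omega
    have hadm : Admissible r (truncatedSupport v j) := by
      intro u
      rcases Nat.lt_or_ge u j with hu | hu
      · have h1 := Finset.card_filter_add_card_filter_not (s := truncatedSupport v j)
          fun x => x.1 ≤ u
        have h2 := card_truncatedSupport_filter v (Nat.succ_le_of_lt hu)
        simp only [not_le] at h1
        have h3 := ih (j - (u + 1)) (by omega) (by omega)
        change ((truncatedSupport v j).filter fun x => u < x.1).card = _ at h2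
        rw [Nat.succ_eq_add_one] at h2
        obtain ⟨d, rfl⟩ := Nat.exists_eq_add_of_lt hu
        have h4 : u + d + 1 - (u + 1) = d := by omega
        rw [h4] at h2 h3
        nlinarith
      · exact (Finset.card_filter_le _ _).trans (hcard.trans (Nat.mul_le_mul_right r (by omega)))
    have hind := hH _ (fun x hx => (hle x hx).trans hj) hadm
    rw [linearIndepOn_finset_iff] at hind
    have hzero := hind (fun x => (v x.2).coeff (j - x.1)) (by
      have hext : ∑ x ∈ truncatedSupport v j, (v x.2).coeff (j - x.1) • slidingColumn H x =
          ∑ x ∈ Finset.range (j + 1) ×ˢ Finset.univ,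
            (v x.2).coeff (j - x.1) • slidingColumn H x := by
        refine Finset.sum_subset (Finset.filter_subset _ _) fun x hx hx' => ?_
        have : (v x.2).coeff (j - x.1) = 0 := by
          by_contra h
          exact hx' (Finset.mem_filter.2 ⟨hx, h⟩)
        rw [this, zero_smul]
      rw [hext]
      funext p ρ
      rw [Finset.sum_product]
      simp only [Finset.sum_apply, Pi.smul_apply, slidingColumn, smul_eq_mul, Pi.zero_apply]
      -- Block row p of the dependency is the parity equation at time j - p; rows p > j vanish.
      rcases Nat.lt_or_ge j p with hp | hp
      · refine Finset.sum_eq_zero fun d hd => Finset.sum_eq_zero fun i _ => ?_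
        have := Finset.mem_range.1 hd
        rw [if_neg (by omega), mul_zero]
      · refine Eq.trans (Finset.sum_subset (s₁ := (Finset.range (j - p + 1)).map
          (addLeftEmbedding p)) ?_ ?_).symm (Eq.trans ?_ (hpar (j - p) (by omega) ρ))
        rotate_left 2
        · rw [Finset.sum_map]
          refine Finset.sum_congr rfl fun t ht => Finset.sum_congr rfl fun i _ => ?_
          have h5 : p + t - p = t := by omega
          have h6 : j - (p + t) = j - p - t := by omega
          simp only [addLeftEmbedding_apply, if_pos (Nat.le_add_right p t), h5, h6]
          exact mul_comm _ _
        · intro x hx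
          obtain ⟨t, ht, rfl⟩ := Finset.mem_map.1 hx
          have := Finset.mem_range.1 ht
          rw [addLeftEmbedding_apply, Finset.mem_range]
          omega
        · intro d hd hd'
          refine Finset.sum_eq_zero fun i _ => ?_
          have h7 : ¬ p ≤ d := fun h => hd' (Finset.mem_map.2 ⟨d - p, by
            have := Finset.mem_range.1 hd
            rw [Finset.mem_range]
            omega, by
            rw [addLeftEmbedding_apply]
            omega⟩)
          rw [if_neg h7, mul_zero])
    refine hv (funext fun i => ?_)
    by_contra hne
    have hmem : (j, i) ∈ truncatedSupport v j := by
      simp only [truncatedSupport, Finset.mem_filter, Finset.mem_product, Finset.mem_range,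
        Finset.mem_univ, and_true]
      exact ⟨by omega, by simpa [coeffVec] using hne⟩
    have := hzero _ hmem
    simp only [Nat.sub_self] at this
    exact hne this

end Distance

/-! ### A code built from a dual pair of bases -/

section Generator

variable {F : Type*} [Field F] {n k r δ : ℕ}

/-- The generator matrix built from a basis `a 0, …, a (n - 1)` of `F ^ n`: the `c`-th column of `G` is
`z * a c - a (c + r)` for `c < δ` and `- a (c + r)` for `δ ≤ c`. -/
noncomputable def shiftGenerator (a : ℕ → Fin n → F) (k r δ : ℕ) : Matrix (Fin n) (Fin k) F[X] :=
  Matrix.of fun i c => (if (c : ℕ) < δ then C (a c i) * X else 0) - C (a (c + r) i)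

/-- `b 0, …, b (n - 1)` is the dual basis of `a 0, …, a (n - 1)`. -/
def IsDualPair (b a : ℕ → Fin n → F) : Prop :=
  ∀ x < n, ∀ y < n, ∑ i, b x i * a y i = if x = y then 1 else 0

theorem IsDualPair.linearIndependent {b a : ℕ → Fin n → F} (h : IsDualPair b a)
    {f : Fin k → ℕ} (hf : Function.Injective f) (hfn : ∀ c, f c < n) {ε : Fin k → F}
    (hε : ∀ c, ε c ≠ 0) : LinearIndependent F fun c => ε c • a (f c) := by
  rw [Fintype.linearIndependent_iff]
  intro g hg c
  have h1 : ∑ i, b (f c) i * (∑ d, g d • ε d • a (f d)) i = g c * ε c := by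
    have h2 : ∀ d, ∑ i, b (f c) i * (g d • ε d • a (f d)) i =
        if c = d then g d * ε d else 0 := by
      intro d
      have h3 := h (f c) (hfn c) (f d) (hfn d)
      rw [if_congr hf.eq_iff rfl rfl] at h3
      calc ∑ i, b (f c) i * (g d • ε d • a (f d)) i
          = (g d * ε d) * ∑ i, b (f c) i * a (f d) i := by
            rw [Finset.mul_sum]
            refine Finset.sum_congr rfl fun i _ => ?_
            simp only [Pi.smul_apply, smul_eq_mul]
            ring
        _ = _ := by rw [h3]; split_ifs <;> simp
    simp only [Finset.sum_apply, Finset.mul_sum]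
    rw [Finset.sum_comm]
    simp only [h2]
    simp
  rw [hg] at h1
  simp only [Pi.zero_apply, mul_zero, Finset.sum_const_zero] at h1
  exact (mul_eq_zero.1 h1.symm).resolve_right (hε c)

theorem IsDualPair.sum_mul_shiftGenerator {b a : ℕ → Fin n → F} (h : IsDualPair b a)
    (hn : k + r = n) {x : ℕ} (hx : x < n) (c : Fin k) :
    ∑ i, C (b x i) * shiftGenerator a k r δ i c =
      (if (c : ℕ) < δ ∧ x = c then X else 0) - if x = c + r then 1 else 0 := by
  have h1 : ∀ y < n, ∑ i, C (b x i) * C (a y i) = if x = y then (1 : F[X]) else 0 := by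
    intro y hy
    have := congrArg C (h x hx y hy)
    rw [map_sum] at this
    simp only [map_mul] at this
    rw [this]
    split_ifs <;> simp
  have h2 := h1 c (by omega)
  have h3 := h1 (c + r) (by omega)
  simp only [shiftGenerator, Matrix.of_apply, mul_sub, Finset.sum_sub_distrib, h3]
  congr 1
  by_cases hc : (c : ℕ) < δ
  · simp only [hc, if_true, true_and, ← mul_assoc, ← Finset.sum_mul, h2]
    split_ifs <;> simp
  · simp [hc]

/-- Pairing with b r, …, b (n - 1) gives an upper triangular matrix with diagonal -1: an entry X
needs d = c + r > c. -/
theorem IsDualPair.exists_leftInverse {b a : ℕ → Fin n → F} (h : IsDualPair b a)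
    (hn : k + r = n) (hr : 0 < r) :
    ∃ Q : Matrix (Fin k) (Fin n) F[X], Q * shiftGenerator a k r δ = 1 := by
  let B : Matrix (Fin k) (Fin n) F[X] := Matrix.of fun c i => C (b (c + r) i)
  have hU : ∀ c d, (B * shiftGenerator a k r δ) c d =
      (if (d : ℕ) < δ ∧ (c + r : ℕ) = d then X else 0) - if c = d then 1 else 0 := by
    intro c d
    rw [Matrix.mul_apply]
    have := h.sum_mul_shiftGenerator (δ := δ) hn (x := c + r) (by omega) d
    simp only [add_left_inj, ← Fin.ext_iff] at this
    exact this
  have hdet : IsUnit (B * shiftGenerator a k r δ).det := by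
    rw [Matrix.det_of_isUpperTriangular]
    · have : ∀ c, (B * shiftGenerator a k r δ) c c = -1 := by
        intro c
        rw [hU, if_neg (by omega), if_pos rfl, zero_sub]
      simp only [this, Finset.prod_const]
      exact isUnit_one.neg.pow _
    · intro c d hcd
      have hlt : (d : ℕ) < c := hcd
      rw [hU, if_neg (by omega), if_neg (by rintro rfl; omega), sub_zero]
  exact ⟨(B * shiftGenerator a k r δ)⁻¹ * B, by rw [Matrix.mul_assoc, Matrix.nonsing_inv_mul _ hdet]⟩

theorem maxMinorDegree_shiftGenerator {b a : ℕ → Fin n → F} (h : IsDualPair b a)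
    (hn : k + r = n) (hδ : δ < k) : maxMinorDegree (shiftGenerator a k r δ) = δ := by
  let d : Fin k → ℕ := fun c => if (c : ℕ) < δ then 1 else 0
  have hsum : ∑ c, d c = δ := by
    rw [← Finset.card_filter, Fin.card_filter_val_lt, min_eq_right hδ.le]
  rw [maxMinorDegree_eq_sum _ d, hsum]
  · intro i c
    simp only [shiftGenerator, Matrix.of_apply, d]
    split_ifs
    · exact natDegree_sub_C.trans_le ((natDegree_C_mul_le _ _).trans natDegree_X_le)
    · simp
  · have hcol : (Matrix.of fun i c => (shiftGenerator a k r δ i c).coeff (d c)).col =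
        fun c : Fin k => (if (c : ℕ) < δ then (1 : F) else -1) •
          a (if (c : ℕ) < δ then (c : ℕ) else c + r) := by
      funext c i
      simp only [Matrix.col, Matrix.transpose_apply, Matrix.of_apply, shiftGenerator, d]
      split_ifs <;> simp [coeff_C]
    rw [hcol]
    -- The leading coefficients are a c for c < δ and -a (c + r) for c ≥ δ; the indices are distinct
    -- because the second kind is at least δ.
    refine h.linearIndependent (f := fun c : Fin k => if (c : ℕ) < δ then (c : ℕ) else c + r)
      ?_ ?_ ?_
    · intro c c' hcc
      simp only at hcc
      split_ifs at hcc <;> omega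
    · intro c
      split_ifs <;> omega
    · intro c
      split_ifs <;> simp

theorem linearIndependent_coeff_zero_shiftGenerator {b a : ℕ → Fin n → F} (h : IsDualPair b a)
    (hn : k + r = n) :
    LinearIndependent F (Matrix.of fun i c => (shiftGenerator a k r δ i c).coeff 0).col := by
  have hcol : (Matrix.of fun i c => (shiftGenerator a k r δ i c).coeff 0).col =
      fun c : Fin k => (-1 : F) • a (c + r) := by
    funext c i
    simp only [Matrix.col, Matrix.transpose_apply, Matrix.of_apply, shiftGenerator]
    split_ifs <;> simp
  rw [hcol]
  exact h.linearIndependent (f := fun c : Fin k => (c : ℕ) + r) (ε := fun _ => -1)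
    (fun c d hcd => Fin.ext (Nat.add_right_cancel hcd)) (fun c => by omega) (fun c => by simp)

/-- For v = G m, pairing with b x gives z m_x - m_{x-r}, where the first term is present for x < δ
and the second for x ≥ r. Along x = t * r + ρ, weighted by z^t, this telescopes. -/
theorem IsDualPair.sum_mul_coeff {b a : ℕ → Fin n → F} (h : IsDualPair b a)
    (hn : k + r = n) {v : Fin n → F[X]}
    (hv : v ∈ LinearMap.range (shiftGenerator a k r δ).mulVecLin) {τ ρ : ℕ} (hρ : ρ < r)
    (hτ : τ * r ≤ δ) (hδ : δ < k) :
    ∑ t ∈ Finset.range (τ + 1), ∑ i, b (t * r + ρ) i * (v i).coeff (τ - t) = 0 := by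
  obtain ⟨m, rfl⟩ := hv
  let μ : ℕ → F[X] := fun y => if hy : y < k then m ⟨y, hy⟩ else 0
  have hμ : ∀ c : Fin k, μ c = m c := fun c => by simp [μ]
  have hrow : ∀ x < n, ∑ i, C (b x i) * ((shiftGenerator a k r δ).mulVec m) i =
      (if x < δ then X * μ x else 0) - if r ≤ x then μ (x - r) else 0 := by
    intro x hx
    have h1 : ∑ i, C (b x i) * ((shiftGenerator a k r δ).mulVec m) i =
        ∑ c, (∑ i, C (b x i) * shiftGenerator a k r δ i c) * m c := by
      simp only [Matrix.mulVec, dotProduct, Finset.mul_sum, Finset.sum_mul, mul_assoc]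
      exact Finset.sum_comm
    rw [h1]
    simp only [h.sum_mul_shiftGenerator hn hx, sub_mul, Finset.sum_sub_distrib]
    congr 1
    · split_ifs with hxδ
      · rw [Finset.sum_eq_single ⟨x, hxδ.trans hδ⟩]
        · rw [if_pos ⟨hxδ, rfl⟩, ← hμ]
        · intro c _ hc
          rw [if_neg, zero_mul]
          rintro ⟨-, rfl⟩
          exact hc rfl
        · simp
      · refine Finset.sum_eq_zero fun c _ => ?_
        rw [if_neg (by omega), zero_mul]
    · split_ifs with hxr
      · rw [Finset.sum_eq_single ⟨x - r, by omega⟩]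
        · rw [if_pos (Nat.sub_add_cancel hxr).symm, one_mul, ← hμ]
        · intro c _ hc
          rw [if_neg, zero_mul]
          intro hxc
          exact hc (Fin.ext (by simp only; omega))
        · simp
      · refine Finset.sum_eq_zero fun c _ => ?_
        rw [if_neg (by omega), zero_mul]
  let g : ℕ → F := fun t => (μ (t * r + ρ)).coeff (τ - 1 - t)
  have hterm : ∀ t ∈ Finset.range (τ + 1),
      ∑ i, b (t * r + ρ) i * (((shiftGenerator a k r δ).mulVec m) i).coeff (τ - t) =
        (if t < τ then g t else 0) - if 0 < t then g (t - 1) else 0 := by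
    intro t ht
    have htτ : t ≤ τ := Nat.lt_succ_iff.1 (Finset.mem_range.1 ht)
    have htr : t * r ≤ δ := (Nat.mul_le_mul_right r htτ).trans hτ
    have h2 := congrArg (fun p => p.coeff (τ - t)) (hrow (t * r + ρ) (by omega))
    simp only [finsetSum_coeff, coeff_C_mul, coeff_sub] at h2
    rw [h2]
    congr 1
    · rcases Nat.eq_or_lt_of_le htτ with rfl | hlt
      · rw [if_neg (lt_irrefl t), Nat.sub_self]
        split_ifs <;> simp
      · have h3 : (t + 1) * r ≤ δ := (Nat.mul_le_mul_right r hlt).trans hτ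
        have h4 : τ - t = τ - 1 - t + 1 := by omega
        rw [if_pos hlt, if_pos (by nlinarith), h4, coeff_X_mul]
    · rcases Nat.eq_zero_or_pos t with rfl | hpos
      · rw [if_neg (by omega), if_neg (lt_irrefl 0), coeff_zero]
      · obtain ⟨t, rfl⟩ := Nat.exists_eq_succ_of_ne_zero hpos.ne'
        have h5 : t.succ * r + ρ = t * r + ρ + r := by
          rw [Nat.succ_mul]
          ring
        have h6 : τ - 1 - t = τ - t.succ := by omega
        rw [if_pos (by omega), if_pos hpos, h5, Nat.add_sub_cancel]
        simp only [g, Nat.succ_sub_one, h6]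
  have hmul : (shiftGenerator a k r δ).mulVecLin m = (shiftGenerator a k r δ).mulVec m := rfl
  rw [hmul, Finset.sum_congr rfl hterm, Finset.sum_sub_distrib, Finset.sum_range_succ,
    Finset.sum_range_succ' (fun t => if 0 < t then g (t - 1) else 0)]
  rw [if_neg (lt_irrefl τ), if_neg (lt_irrefl 0), add_zero, add_zero, sub_eq_zero]
  refine Finset.sum_congr rfl fun t ht => ?_
  rw [if_pos (Finset.mem_range.1 ht), if_pos (Nat.succ_pos t), Nat.add_sub_cancel]

theorem exists_linearIndependent_extension {m d : ℕ} (hm : m + d = n) (f : ℕ → Fin n → F)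
    (hf : LinearIndependent F fun x : Fin m => f x) :
    ∃ b : ℕ → Fin n → F, (∀ x < m, b x = f x) ∧ LinearIndependent F fun x : Fin n => b x := by
  classical
  induction d generalizing m f with
  | zero =>
    obtain rfl : m = n := hm
    exact ⟨f, fun _ _ => rfl, hf⟩
  | succ d ih =>
    obtain ⟨y, hy⟩ := exists_linearIndependent_snoc_of_lt_finrank hf
      (by rw [Module.finrank_fin_fun]; omega)
    obtain ⟨b, hb, hbi⟩ := ih (m := m + 1) (by omega) (Function.update f m y) (by
      convert! hy using 1
      funext x
      refine Fin.lastCases ?_ (fun x => ?_) x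
      · simp
      · rw [Fin.snoc_castSucc, Fin.val_castSucc, Function.update_of_ne x.2.ne])
    refine ⟨b, fun x hx => ?_, hbi⟩
    rw [hb x (by omega), Function.update_of_ne hx.ne]

theorem exists_isDualPair (b : ℕ → Fin n → F) (hb : LinearIndependent F fun x : Fin n => b x) :
    ∃ a, IsDualPair b a := by
  let B : Matrix (Fin n) (Fin n) F := Matrix.of fun x i => b x i
  have hB : IsUnit B := Matrix.linearIndependent_rows_iff_isUnit.1 hb
  refine ⟨fun y i => if hy : y < n then B⁻¹ i ⟨y, hy⟩ else 0, fun x hx y hy => ?_⟩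
  have h1 := congrFun (congrFun (Matrix.mul_nonsing_inv B ((Matrix.isUnit_iff_isUnit_det B).1 hB))
    ⟨x, hx⟩) ⟨y, hy⟩
  rw [Matrix.mul_apply, Matrix.one_apply] at h1
  simp only [Fin.mk.injEq] at h1
  simp only [hy, dif_pos]
  exact h1

/-- Any (s + 1) * r columns of level s form an admissible set. Up to the order of block rows they
are a square submatrix of the stacked H_0, …, H_s, which is thus invertible. -/
theorem Superregular.linearIndependent_rows {H : ℕ → Fin r → Fin n → F} {s : ℕ}
    (hH : Superregular H s) (hr : 0 < r) (hn : (s + 1) * r ≤ n) :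
    LinearIndependent F fun x : Fin ((s + 1) * r) =>
      H (x / r) ⟨x % r, Nat.mod_lt _ hr⟩ := by
  classical
  let N : Matrix (Fin ((s + 1) * r)) (Fin ((s + 1) * r)) F :=
    Matrix.of fun x y => H (x / r) ⟨x % r, Nat.mod_lt _ hr⟩ (Fin.castLE hn y)
  let K : Finset (ℕ × Fin n) := Finset.univ.map
    ⟨fun y : Fin ((s + 1) * r) => (s, Fin.castLE hn y), fun y z h => by
      simpa using h⟩
  have hKs : ∀ x ∈ K, x.1 = s := by
    intro x hx
    obtain ⟨y, -, rfl⟩ := Finset.mem_map.1 hx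
    rfl
  have hadm : Admissible r K := by
    intro u
    rcases Nat.lt_or_ge u s with hu | hu
    · rw [Finset.filter_false_of_mem fun x hx => by rw [hKs x hx]; omega]
      simp
    · refine (Finset.card_filter_le _ _).trans ?_
      rw [Finset.card_map, Finset.card_univ, Fintype.card_fin]
      exact Nat.mul_le_mul_right r (by omega)
  have hind := hH K (fun x hx => (hKs x hx).le) hadm
  have hcols : LinearIndependent F N.col := by
    rw [Fintype.linearIndependent_iff]
    intro g hg
    have hind' : LinearIndependent F fun y : Fin ((s + 1) * r) =>
        slidingColumn H (s, Fin.castLE hn y) := by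
      refine hind.comp (fun y : Fin ((s + 1) * r) => ⟨(s, Fin.castLE hn y), ?_⟩) ?_
      · exact Finset.mem_coe.2 (Finset.mem_map.2 ⟨y, Finset.mem_univ y, rfl⟩)
      · intro y z h
        simpa using h
    rw [Fintype.linearIndependent_iff] at hind'
    refine hind' g ?_
    funext p ρ
    simp only [Finset.sum_apply, Pi.smul_apply, slidingColumn, Pi.zero_apply]
    rcases Nat.lt_or_ge s p with hp | hp
    · refine Finset.sum_eq_zero fun y _ => ?_
      rw [if_neg (by omega), smul_zero]
    · have hlt : (s - p) * r + ρ < (s + 1) * r := by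
        have : (s - p + 1) * r ≤ (s + 1) * r := Nat.mul_le_mul_right r (by omega)
        have := ρ.2
        nlinarith
      have h1 := congrFun hg ⟨(s - p) * r + ρ, hlt⟩
      have h2 : ((s - p) * r + ρ) / r = s - p := by
        rw [mul_comm, Nat.mul_add_div hr, Nat.div_eq_of_lt ρ.2, add_zero]
      have h3 : ((s - p) * r + ρ) % r = ρ := by
        rw [mul_comm, Nat.mul_add_mod, Nat.mod_eq_of_lt ρ.2]
      simpa [N, Matrix.col, Finset.sum_apply, h2, h3, hp] using h1
  have hrows := Matrix.linearIndependent_rows_iff_isUnit.2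
    (Matrix.linearIndependent_cols_iff_isUnit.1 hcols)
  exact LinearIndependent.of_comp (LinearMap.funLeft F F (Fin.castLE hn)) hrows

end Generator

/-! ### Assembling the code and checking the field size -/

section Main

variable {F : Type*} [Field F] {n k r δ : ℕ}

theorem Superregular.exists_code {H : ℕ → Fin (n - k) → Fin n → F} (hkn : k < n) (hδ : δ < k)
    (hH : Superregular H (L n k δ)) :
    ∃ C : Submodule F[X] (Fin n → F[X]),
      IsConvolutionalCode C k δ ∧ IsNonCatastrophic C k ∧ IsMDP C k δ := by
  have hr : 0 < n - k := by omega
  have hn : k + (n - k) = n := by omega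
  -- Here δ < k makes the term δ / k of `L` vanish; it also gives room for all (L + 1)(n - k) rows
  -- in a basis.
  have hL : L n k δ * (n - k) ≤ δ := by
    rw [L, Nat.div_eq_of_lt hδ, zero_add]
    exact Nat.div_mul_le_self _ _
  have hLn : (L n k δ + 1) * (n - k) ≤ n := by
    rw [add_mul, one_mul]
    omega
  obtain ⟨d, hd⟩ := Nat.exists_eq_add_of_le hLn
  obtain ⟨b, hbH, hbi⟩ := exists_linearIndependent_extension hd.symm
    (fun x => H (x / (n - k)) ⟨x % (n - k), Nat.mod_lt _ hr⟩) (hH.linearIndependent_rows hr hLn)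
  obtain ⟨a, hba⟩ := exists_isDualPair b hbi
  obtain ⟨Q, hQ⟩ := hba.exists_leftInverse (δ := δ) hn hr
  set G : Matrix (Fin n) (Fin k) F[X] := shiftGenerator a k (n - k) δ
  have hinj : Function.Injective G.mulVec := by
    intro x y hxy
    have := congrArg Q.mulVec hxy
    rwa [Matrix.mulVec_mulVec, Matrix.mulVec_mulVec, hQ, Matrix.one_mulVec,
      Matrix.one_mulVec] at this
  have hgen : IsGeneratorMatrix G (LinearMap.range G.mulVecLin) :=
    ⟨Matrix.mulVec_injective_iff.1 hinj, rfl⟩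
  refine ⟨LinearMap.range G.mulVecLin, ⟨inferInstance, ?_, G, hgen, ?_⟩, ⟨G, hgen, fun z => ?_⟩, ?_⟩
  · rw [LinearMap.finrank_range_of_inj hinj, Module.finrank_fin_fun]
  · exact maxMinorDegree_shiftGenerator hba hn hδ
  · refine le_antisymm (Matrix.rank_le_width _) ?_
    have h1 := congrArg (fun M : Matrix (Fin k) (Fin k) F[X] => M.map (aeval z)) hQ
    simp only [Matrix.map_mul, Matrix.map_one _ (map_zero (aeval z)) (map_one (aeval z))] at h1
    have h2 := Matrix.rank_mul_le_right (Q.map (aeval z)) (G.map (aeval z))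
    rw [h1, Matrix.rank_one, Fintype.card_fin] at h2
    exact h2
  · intro j hj
    have hlow : ∀ v ∈ LinearMap.range G.mulVecLin, coeffVec v 0 ≠ 0 →
        (n - k) * (j + 1) + 1 ≤ truncatedWeight v j := by
      intro v hv hv0
      rw [mul_comm]
      refine hH.lt_truncatedWeight (fun τ hτ ρ => ?_) hv0 j hj
      rw [← hba.sum_mul_coeff hn hv ρ.2 ((Nat.mul_le_mul_right _ hτ).trans hL) hδ]
      refine Finset.sum_congr rfl fun t ht => Finset.sum_congr rfl fun i _ => ?_
      have htL : t ≤ L n k δ := (Nat.lt_succ_iff.1 (Finset.mem_range.1 ht)).trans hτ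
      have hlt : t * (n - k) + ρ < (L n k δ + 1) * (n - k) := by
        have h1 : (t + 1) * (n - k) ≤ (L n k δ + 1) * (n - k) :=
          Nat.mul_le_mul_right _ (by omega)
        have h2 := ρ.2
        rw [add_mul, one_mul] at h1
        omega
      have h2 : (t * (n - k) + ρ) / (n - k) = t := by
        rw [mul_comm, Nat.mul_add_div hr, Nat.div_eq_of_lt ρ.2, add_zero]
      have h3 : (t * (n - k) + ρ) % (n - k) = ρ := by
        rw [mul_comm, Nat.mul_add_mod, Nat.mod_eq_of_lt ρ.2]
      rw [hbH _ hlt]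
      simp only [h2, h3]
    obtain ⟨v, hv, hv0, hle⟩ := exists_truncatedWeight_le (by omega) G
      (linearIndependent_coeff_zero_shiftGenerator hba hn) j
    refine IsLeast.csInf_eq ⟨⟨v, hv, hv0, le_antisymm hle (hlow v hv hv0)⟩, ?_⟩
    rintro w ⟨v', hv', hv0', rfl⟩
    exact hlow v' hv' hv0'

theorem le_choose {a b : ℕ} (hb : 0 < b) (hba : b < a) : a ≤ a.choose b := by
  induction a generalizing b with
  | zero => omega
  | succ a ih =>
    obtain ⟨c, rfl⟩ := Nat.exists_eq_succ_of_ne_zero hb.ne'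
    rcases Nat.eq_or_lt_of_le (Nat.lt_succ_iff.1 hba) with h | h
    · rw [h, Nat.choose_succ_self_right]
    · rw [Nat.choose_succ_succ]
      have h1 := ih hb h
      have h2 : 0 < a.choose c := Nat.choose_pos (by omega)
      omega

theorem exists_superregular_of_lt_card (hkn : k < n) (hδ : δ < k)
    (hF : (((((L n k δ + 1) * n - 1).choose ((L n k δ + 1) * (n - k) - 1) : ℕ) : ℕ∞) <
        ENat.card F) ∨ (1 ≤ L n k δ ∧ ((S n k δ : ℕ) : ℕ∞) < ENat.card F)) :
    ∃ H : ℕ → Fin (n - k) → Fin n → F, Superregular H (L n k δ) := by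
  have hr : 0 < n - k := by omega
  have hLn : (L n k δ + 1) * (n - k) < n := by
    have hL : L n k δ * (n - k) ≤ δ := by
      rw [L, Nat.div_eq_of_lt hδ, zero_add]
      exact Nat.div_mul_le_self _ _
    rw [add_mul, one_mul]
    omega
  have hcard : ∀ {N : ℕ}, n - 1 ≤ N → (N : ℕ∞) < ENat.card F → (n : ℕ∞) ≤ ENat.card F := by
    intro N hN h
    refine le_trans ?_ (Order.add_one_le_of_lt h)
    exact_mod_cast (by omega : n ≤ N + 1)
  refine exists_superregular ?_ hLn.le fun s hs i => ?_
  · rcases hF with h | ⟨h1, h⟩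
    · rcases Nat.eq_or_lt_of_le (show 1 ≤ (L n k δ + 1) * (n - k) from Nat.mul_pos (by omega) hr)
        with h2 | h2
      · exact Or.inr (Nat.eq_one_of_mul_eq_one_left h2.symm)
      · refine Or.inl (hcard ?_ h)
        have h3 : n ≤ (L n k δ + 1) * n := Nat.le_mul_of_pos_left n (by omega)
        exact le_trans (by omega) (le_choose (by omega) (by omega))
    · refine Or.inl (hcard ?_ h)
      -- The last summand of `S` alone is at least n - 1.
      have h2 : 2 * 1 ≤ (L n k δ + 1) * (n - k) := Nat.mul_le_mul (by omega) hr
      refine (le_choose (b := (L n k δ + 1) * (n - k) - 1) (by omega) (by omega)).trans ?_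
      rw [S]
      exact Nat.le_add_left _ _
  · refine lt_of_le_of_lt (Nat.cast_le.2
      (card_criticalSets_mono (Nat.sub_le n k) i (Nat.succ_le_of_lt hs))) ?_
    rcases hF with h | ⟨h1, h⟩
    · exact lt_of_le_of_lt (Nat.cast_le.2 (card_criticalSets_le_choose _ i)) h
    · exact lt_of_le_of_lt (Nat.cast_le.2 (card_criticalSets_le_S hkn h1 i)) h

end Main

end ConvCode

theorem mainTheorem2 (F : Type*) [Field F] (n k δ : ℕ) (hkn : k < n) (hδ : δ < k)
    (hF : (((((ConvCode.L n k δ + 1) * n - 1).choose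
              ((ConvCode.L n k δ + 1) * (n - k) - 1) : ℕ) : ℕ∞) < ENat.card F) ∨
          (1 ≤ ConvCode.L n k δ ∧ ((ConvCode.S n k δ : ℕ) : ℕ∞) < ENat.card F)) :
    ∃ C : Submodule (Polynomial F) (Fin n → Polynomial F),
      ConvCode.IsConvolutionalCode C k δ ∧
      ConvCode.IsNonCatastrophic C k ∧
      ConvCode.IsMDP C k δ := by
  obtain ⟨H, hH⟩ := ConvCode.exists_superregular_of_lt_card hkn hδ hF
  exact hH.exists_code hkn hδ
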